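/- Let $\mathcal H$ be a finite-dimensional complex Hilbert space, $\mathcal B(\mathcal H)$ its endomorphisms, and let $k\ge 0$. Identify the Grassmannian $\mathbf G\mathcal H=\mathbf G_k\mathcal H$ of $k$-dimensional subspaces with the set of rank-$k$ Hermitian projections $q\in\mathcal B(\mathcal H)$, and the fibre at $q$ of its cotangent bundle with the complex vector space $$\mathrm T^*_q\mathbf G\mathcal H=\{A\in\mathcal B(\mathcal H): qA=A,\ Aq=0\}\;\cong\;\mathrm{Hom}(V^\perp,V),\qquad V=q\mathcal H .$$ Let $S$ be the section of $(\mathrm T^*\mathbf G\mathcal H)^*\boxtimes \mathrm T^*\mathbf G\mathcal H\to\mathbf G\mathcal H\times\mathbf G\mathcal H$ whose value at $(q,p)$ is the linear map $$S(q,p):\mathrm T^*_q\mathbf G\mathcal H\to \mathrm T^*_p\mathbf G\mathcal H,\qquad A\mapsto A\,S(q,p):=pA-pAp .$$ The Fubini–Study metric on $\mathbf G\mathcal H$ is $(A,B)\mapsto \mathrm{Tr}(AB)$ on the tangent spaces $\mathrm T_q\mathbf G\mathcal H=\{A=A^*: qA+Aq=A\}$. Then: 1. $S(q,q)$ is the identity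 for every $q\in\mathbf G\mathcal H$. 2. $S$ is Hermitian: $\mathrm{Tr}\big((A\,S(q,p))^*B\big)=\mathrm{Tr}\big(A^*(B\,S(p,q))\big)$ for all $q,p\in\mathbf G\mathcal H$, $A\in \mathrm T^*_q\mathbf G\mathcal H$, $B\in \mathrm T^*_p\mathbf G\mathcal H$. 3. $S$ is idempotent with respect to the suitably normalized Fubini–Study volume: there is a unique Borel measure $\mathrm{vol}$ on $\mathbf G\mathcal H$ given by $\sqrt{\det(g_{ij})}\,dx$ in all smooth local coordinates, where $g$ is the Fubini–Study metric, and there is a constant $\lambda>0$ such that, with $dq'=\lambda^{-1}\,d\mathrm{vol}(q')$, for all $q,p\in\mathbf G\mathcal H$ $$S(q,p)=\int_{\mathbf G\mathcal H}S(q,q')\,S(q',p)\,dq'$$ (the product meaning first $S(q,q')$, then $S(q',p)$), the integrand being integrable. Moreover, if $0<k<\dim\mathcal H$, then for the same $\lambda$ and every traceless $M\in\mathcal B(\mathcal H)$ the map $q\mapsto qM-qMq$ is integrable and $$\int_{\mathbf G\mathcal H}(qM-qMq)\,d\mathrm{vol}(q)=\lambda M .$$ -/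

import Mathlib

set_option maxSynthPendingDepth 3

open MeasureTheory
open scoped NNReal ContDiff

/-- The Grassmannian of `k`-dimensional subspaces of `H`, identified with the space of rank-`k`
Hermitian projections. It carries the topology and the Borel sets induced from `H →L[ℂ] H`. -/
abbrev ProjGrassmannian (k : ℕ) (H : Type*) [NormedAddCommGroup H] [InnerProductSpace ℂ H]
    [CompleteSpace H] : Type _ :=
  {q : H →L[ℂ] H // IsStarProjection q ∧ Module.finrank ℂ (LinearMap.range (q : H →ₗ[ℂ] H)) = k}

/-- The trace of an endomorphism. -/
noncomputable def opTrace {H : Type*} [NormedAddCommGroup H] [InnerProductSpace ℂ H]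
    (A : H →L[ℂ] H) : ℂ :=
  LinearMap.trace ℂ H (A : H →ₗ[ℂ] H)

section Fibers

variable {H : Type*} [NormedAddCommGroup H] [InnerProductSpace ℂ H] [CompleteSpace H] {k : ℕ}

/-- The fibre over `q` of the cotangent bundle of the Grassmannian: the operators `A` with
`qA = A` and `Aq = 0`, i.e. `Hom(V^⊥, V)` for `V` the image of `q`. -/
def cotangentFiber (q : ProjGrassmannian k H) : Submodule ℂ (H →L[ℂ] H) where
  carrier := {A | q.1 * A = A ∧ A * q.1 = 0}
  add_mem' := by
    rintro A B ⟨hA, hA'⟩ ⟨hB, hB'⟩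
    exact ⟨by rw [mul_add, hA, hB], by rw [add_mul, hA', hB', add_zero]⟩
  zero_mem' := ⟨mul_zero _, zero_mul _⟩
  smul_mem' := by
    rintro c A ⟨hA, hA'⟩
    exact ⟨by rw [mul_smul_comm, hA], by rw [smul_mul_assoc, hA', smul_zero]⟩

theorem section_mem_cotangentFiber (p : ProjGrassmannian k H) (M : H →L[ℂ] H) :
    p.1 * M - p.1 * M * p.1 ∈ cotangentFiber p := by
  have hp : p.1 * p.1 = p.1 := p.2.1.isIdempotentElem
  refine ⟨?_, ?_⟩
  · rw [mul_sub, ← mul_assoc, ← mul_assoc, ← mul_assoc, hp]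
  · rw [sub_mul, mul_assoc (p.1 * M), hp, sub_self]

/-- The section `S` of `(T*G)^* ⊠ T*G` over `G × G`: its value at `(q, p)` is the linear map
`T*_q G → T*_p G`, `A ↦ pA - pAp`. -/
def idemSection (q p : ProjGrassmannian k H) : cotangentFiber q →L[ℂ] cotangentFiber p where
  toFun A := ⟨p.1 * A.1 - p.1 * A.1 * p.1, section_mem_cotangentFiber p A.1⟩
  map_add' A B := Subtype.ext (by simp only [Submodule.coe_add]; noncomm_ring)
  map_smul' c A := Subtype.ext (by
    simp only [Submodule.coe_smul, mul_smul_comm, smul_mul_assoc, smul_sub, RingHom.id_apply])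
  cont := by
    refine Continuous.subtype_mk ?_ _
    exact (continuous_const.mul continuous_subtype_val).sub
      ((continuous_const.mul continuous_subtype_val).mul continuous_const)

end Fibers

section Volume

/-- The real dimension `2k(n-k)` of the Grassmannian of `k`-planes in an `n`-dimensional space
(for `k ≤ n`; otherwise the Grassmannian is empty). -/
noncomputable def grassDim (k : ℕ) (H : Type*) [NormedAddCommGroup H] [InnerProductSpace ℂ H] : ℕ :=
  2 * (k * (Module.finrank ℂ H - k))

variable {H : Type*} [NormedAddCommGroup H] [InnerProductSpace ℂ H]

/-- The Fubini-Study metric `(A, B) ↦ Tr(AB)` on the tangent vectors of the Grassmannian at `q`,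
which are the Hermitian operators `A` with `qA + Aq = A`. (The trace is real for such operators;
the formula does not involve `q`.) -/
noncomputable def fubiniStudyMetric (A B : H →L[ℂ] H) : ℝ := (opTrace (A * B)).re

/-- `φ` restricted to the open set `U ⊆ ℝ^d` is a smooth local parametrization (the inverse of
a chart) of the Grassmannian, `d` being its real dimension. -/
structure IsLocalParametrization [CompleteSpace H] (k : ℕ)
    (φ : EuclideanSpace ℝ (Fin (grassDim k H)) → H →L[ℂ] H)
    (U : Set (EuclideanSpace ℝ (Fin (grassDim k H)))) : Prop where
  isOpen : IsOpen U
  smooth : ContDiffOn ℝ ∞ φ U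
  injOn : Set.InjOn φ U
  immersion : ∀ x ∈ U, Function.Injective (fderiv ℝ φ x)
  mapsTo : ∀ x ∈ U, IsStarProjection (φ x) ∧
    Module.finrank ℂ (LinearMap.range (φ x : H →ₗ[ℂ] H)) = k

/-- The matrix `(g_{ij}(x))` of the Fubini-Study metric in the coordinates given by `φ`. -/
noncomputable def metricMatrix {d : ℕ} (φ : EuclideanSpace ℝ (Fin d) → H →L[ℂ] H)
    (x : EuclideanSpace ℝ (Fin d)) : Matrix (Fin d) (Fin d) ℝ :=
  Matrix.of fun i j => fubiniStudyMetric
    (fderiv ℝ φ x (EuclideanSpace.single i 1)) (fderiv ℝ φ x (EuclideanSpace.single j 1))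

/-- `vol` is the Riemannian volume measure of the Fubini-Study metric: in all local coordinates
it is `√(det g) dx`. -/
def IsFubiniStudyVolume [CompleteSpace H] {k : ℕ} (vol : Measure (ProjGrassmannian k H)) : Prop :=
  ∀ φ U, IsLocalParametrization k φ U → ∀ s, MeasurableSet s → s ⊆ U →
    vol {q | q.1 ∈ φ '' s} = ∫⁻ x in s, ENNReal.ofReal √(metricMatrix φ x).det

end Volume

/-! With the Hilbert–Schmidt product on `H →L[ℂ] H`, the map `M ↦ pM - pMp = pM(1-p)` is the
orthogonal projection onto the cotangent fibre at `p`, and `S(q,p)` is its restriction to the fibre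
at `q`. This gives the identity on the diagonal and Hermitian symmetry, since both traces in the
latter equal `Tr(A*B)`.

For idempotency, the integral of `S(q,q')S(q',p)` applied to `A` is the projection onto the fibre at
`p` of `∫ (q'A - q'Aq')`. As `A` is traceless, it suffices that `M ↦ ∫ (qM - qMq)` acts on traceless
`M` as a positive scalar. The volume is invariant under unitary conjugation, so `C(M) = ∫ qMq` is
equivariant and, as in Schur's lemma, `C(M) = aM + b Tr(M) 1` (`exists_averageCompression_eq`).
Setting `M = 1` gives `∫ q = (a + bn) 1`, with `n = dim H`, so the scalar is `bn`. Integrating `Tr q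
= k` and `(Tr q)² = k²` gives two linear equations for `a` and `b`, whence `λ = bn = vol ·
k(n-k)/(n²-1)`.

The volume itself is built from graph charts: near `V = qH` a subspace is the graph of a unique `X :
V → V^⊥`. By the change of variables formula `√(det g) dx` does not depend on coordinates
(`IsLocalParametrization.lintegral_density_eq`), so the chart measures glue along a finite atlas.
Uniqueness then yields unitary invariance, because conjugation preserves the metric. -/

/-! ### The trace and Hermitian projections -/

section Trace

variable {H : Type*} [NormedAddCommGroup H] [InnerProductSpace ℂ H]

theorem opTrace_add (A B : H →L[ℂ] H) : opTrace (A + B) = opTrace A + opTrace B := by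
  simp [opTrace]

theorem opTrace_sub (A B : H →L[ℂ] H) : opTrace (A - B) = opTrace A - opTrace B := by
  simp [opTrace]

theorem opTrace_smul (c : ℂ) (A : H →L[ℂ] H) : opTrace (c • A) = c * opTrace A := by
  simp [opTrace]

theorem opTrace_mul_comm (A B : H →L[ℂ] H) : opTrace (A * B) = opTrace (B * A) :=
  LinearMap.trace_mul_comm ℂ (A : H →ₗ[ℂ] H) (B : H →ₗ[ℂ] H)

variable [FiniteDimensional ℂ H]

theorem opTrace_one : opTrace (1 : H →L[ℂ] H) = Module.finrank ℂ H := LinearMap.trace_one ℂ H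

theorem opTrace_eq_finrank_range {q : H →L[ℂ] H} (hq : IsIdempotentElem q) :
    opTrace q = (Module.finrank ℂ (LinearMap.range (q : H →ₗ[ℂ] H)) : ℂ) := by
  have h : IsIdempotentElem (q : H →ₗ[ℂ] H) :=
    congrArg (fun f : H →L[ℂ] H => (f : H →ₗ[ℂ] H)) hq
  exact ((LinearMap.isProj_range_iff_isIdempotentElem _).2 h).trace

/-- Replaces the rank by the trace, which is continuous, linear and invariant under conjugation. -/
theorem finrank_range_eq_iff {q : H →L[ℂ] H} (hq : IsIdempotentElem q) (k : ℕ) :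
    Module.finrank ℂ (LinearMap.range (q : H →ₗ[ℂ] H)) = k ↔ opTrace q = k := by
  rw [opTrace_eq_finrank_range hq, Nat.cast_inj]

theorem continuous_opTrace : Continuous (opTrace : (H →L[ℂ] H) → ℂ) :=
  ((LinearMap.trace ℂ H) ∘ₗ (ContinuousLinearMap.coeLM ℂ)).continuous_of_finiteDimensional

variable [CompleteSpace H]

theorem opTrace_star_mul_self (A : H →L[ℂ] H) :
    opTrace (star A * A) = ((∑ i, ‖A (stdOrthonormalBasis ℂ H i)‖ ^ 2 : ℝ) : ℂ) := by
  rw [opTrace, LinearMap.trace_eq_sum_inner _ (stdOrthonormalBasis ℂ H), Complex.ofReal_sum]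
  refine Finset.sum_congr rfl fun i _ => ?_
  simp [ContinuousLinearMap.star_eq_adjoint, ContinuousLinearMap.adjoint_inner_right]

theorem opTrace_star_mul_self_re_nonneg (A : H →L[ℂ] H) : 0 ≤ (opTrace (star A * A)).re := by
  rw [opTrace_star_mul_self, Complex.ofReal_re]
  positivity

theorem eq_zero_of_opTrace_star_mul_self {A : H →L[ℂ] H} (h : (opTrace (star A * A)).re = 0) :
    A = 0 := by
  rw [opTrace_star_mul_self, Complex.ofReal_re,
    Finset.sum_eq_zero_iff_of_nonneg fun _ _ => by positivity] at h
  ext1 x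
  have h' : (A : H →ₗ[ℂ] H) = 0 := (stdOrthonormalBasis ℂ H).toBasis.ext fun i => by
    simpa using h i (Finset.mem_univ i)
  exact LinearMap.congr_fun h' x

/-- Here `q - p` is again a Hermitian projection, so its trace, which is zero, is its squared
Hilbert–Schmidt norm. -/
theorem IsStarProjection.eq_of_mul_eq_of_opTrace_eq {p q : H →L[ℂ] H} (hp : IsStarProjection p)
    (hq : IsStarProjection q) (h : q * p = p) (ht : opTrace p = opTrace q) : p = q := by
  have h' : p * q = p := by
    have := congrArg star h
    rwa [star_mul, hp.isSelfAdjoint.star_eq, hq.isSelfAdjoint.star_eq] at this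
  have h0 : star (q - p) * (q - p) = q - p := by
    rw [star_sub, hp.isSelfAdjoint.star_eq, hq.isSelfAdjoint.star_eq, sub_mul, mul_sub, mul_sub,
      hp.isIdempotentElem.eq, hq.isIdempotentElem.eq, h, h', sub_self, sub_zero]
  refine (sub_eq_zero.1 (eq_zero_of_opTrace_star_mul_self ?_)).symm
  rw [h0, opTrace_sub, ht, sub_self, Complex.zero_re]

/-- The quadratic form of `1 + X*X` at `v` is `‖v‖² + ‖Xv‖²`, so the kernel is trivial. -/
theorem isUnit_one_add_star_mul_self (X : H →L[ℂ] H) : IsUnit (1 + star X * X) := by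
  rw [ContinuousLinearMap.isUnit_iff_isUnit_toLinearMap, LinearMap.isUnit_iff_ker_eq_bot,
    LinearMap.ker_eq_bot']
  intro v hv
  have h1 : inner ℂ v ((1 + star X * X) v) = ((‖v‖ ^ 2 + ‖X v‖ ^ 2 : ℝ) : ℂ) := by
    simp [ContinuousLinearMap.star_eq_adjoint, ContinuousLinearMap.adjoint_inner_right]
  have hv' : (1 + star X * X) v = 0 := hv
  rw [hv', inner_zero_right] at h1
  have h2 : ‖v‖ ^ 2 + ‖X v‖ ^ 2 = 0 := by exact_mod_cast h1.symm
  have : ‖v‖ ^ 2 = 0 := le_antisymm (by nlinarith [sq_nonneg ‖X v‖]) (sq_nonneg _)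
  simpa using this

end Trace

/-! ### Graph coordinates: subspaces near `V` as graphs of maps `V → V^⊥` -/

section GraphProjection

variable {H : Type*} [NormedAddCommGroup H] [InnerProductSpace ℂ H] [CompleteSpace H]

/-- The orthogonal projection onto the graph of `X : V → V^⊥`, where `V` is the image of `q`. -/
noncomputable def graphProjection (q X : H →L[ℂ] H) : H →L[ℂ] H :=
  (1 + X) * q * Ring.inverse (1 + star X * X) * (1 + star X)

/-- An operator that is invertible if and only if the image of `p` is the graph of an operator
`V → V^⊥`, where `V` is the image of `q`. -/
def cornerOp (q p : H →L[ℂ] H) : H →L[ℂ] H := q * p * q + (1 - q)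

/-- The operator of which the image of `p` is the graph. -/
noncomputable def graphOperator (q p : H →L[ℂ] H) : H →L[ℂ] H :=
  (1 - q) * (p * Ring.inverse (cornerOp q p)) * q

variable {q X p : H →L[ℂ] H}

theorem commute_one_add_star_mul_self (hq : IsStarProjection q) (hX' : X * q = X) :
    q * (1 + star X * X) = (1 + star X * X) * q := by
  have h : q * star X = star X := by
    simpa [hq.isSelfAdjoint.star_eq] using congrArg star hX'
  rw [mul_add, add_mul, mul_one, one_mul, ← mul_assoc, h, mul_assoc, hX']

theorem graph_gram (hq : IsStarProjection q) (hX : q * X = 0) (hX' : X * q = X) :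
    q * (1 + star X) * (1 + X) * q = q * (1 + star X * X) := by
  have h : q * star X = star X := by
    simpa [hq.isSelfAdjoint.star_eq] using congrArg star hX'
  have h2 : star X * q = 0 := by
    simpa [hq.isSelfAdjoint.star_eq] using congrArg star hX
  have : q * (1 + star X) * (1 + X) * q
      = q * q + q * star X * q + q * (X * q) + q * star X * (X * q) := by noncomm_ring
  rw [this, hq.isIdempotentElem.eq, h, h2, hX', hX, mul_add, mul_one, ← mul_assoc q, h, add_zero,
    add_zero]

theorem mul_graphOperator (hq : IsStarProjection q) : q * graphOperator q p = 0 := by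
  unfold graphOperator
  rw [mul_assoc, ← mul_assoc, mul_sub, hq.isIdempotentElem.eq, mul_one, sub_self, zero_mul]

theorem graphOperator_mul (hq : IsStarProjection q) : graphOperator q p * q = graphOperator q p := by
  unfold graphOperator
  rw [mul_assoc, hq.isIdempotentElem.eq]

theorem cornerOp_self (hq : IsStarProjection q) : cornerOp q q = 1 := by
  simp [cornerOp, hq.isIdempotentElem.eq]

variable [FiniteDimensional ℂ H]

theorem commute_inverse_one_add_star_mul_self (hq : IsStarProjection q) (hX' : X * q = X) :
    q * Ring.inverse (1 + star X * X) = Ring.inverse (1 + star X * X) * q := by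
  have hu := isUnit_one_add_star_mul_self X
  have h := commute_one_add_star_mul_self hq hX'
  set c := 1 + star X * X
  calc q * Ring.inverse c = Ring.inverse c * (c * q) * Ring.inverse c := by
        rw [← mul_assoc, Ring.inverse_mul_cancel _ hu, one_mul]
    _ = Ring.inverse c * q := by
        rw [← h, ← mul_assoc, mul_assoc, Ring.mul_inverse_cancel _ hu, mul_one]

/-- The graph is the range of `T = (1 + X)q`, and the projection onto it is `T (T*T)⁻¹ T*`. By
`graph_gram`, `T*T` is `1 + X*X` on `V`; that operator commutes with `q` and is invertible on all of
`H`, so its global inverse serves. -/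
theorem isStarProjection_graphProjection (hq : IsStarProjection q) (hX : q * X = 0)
    (hX' : X * q = X) : IsStarProjection (graphProjection q X) := by
  have hu := isUnit_one_add_star_mul_self X
  have hc := commute_inverse_one_add_star_mul_self hq hX'
  have hg := graph_gram hq hX hX'
  have hs : star (Ring.inverse (1 + star X * X)) = Ring.inverse (1 + star X * X) := by
    rw [← Ring.inverse_star]
    simp
  rw [isStarProjection_iff]
  unfold graphProjection
  set c := 1 + star X * X
  set r := Ring.inverse c
  constructor
  · calc (1 + X) * q * r * (1 + star X) * ((1 + X) * q * r * (1 + star X))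
        = (1 + X) * (q * r) * (1 + star X) * (1 + X) * q * r * (1 + star X) := by
          noncomm_ring
      _ = (1 + X) * r * (q * (1 + star X) * (1 + X) * q) * r * (1 + star X) := by
          rw [hc]; simp only [mul_assoc]
      _ = (1 + X) * (r * q) * (c * r) * (1 + star X) := by
          rw [hg]; simp only [mul_assoc]
      _ = _ := by
          rw [Ring.mul_inverse_cancel _ hu, ← hc]; simp only [mul_assoc, one_mul]
  · rw [isSelfAdjoint_iff]
    simp only [star_mul, star_add, star_one, star_star, hs, hq.isSelfAdjoint.star_eq]
    rw [← mul_assoc r, ← hc]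
    simp only [mul_assoc]

theorem opTrace_graphProjection (hq : IsStarProjection q) (hX : q * X = 0)
    (hX' : X * q = X) : opTrace (graphProjection q X) = opTrace q := by
  have hu := isUnit_one_add_star_mul_self X
  have hc := commute_inverse_one_add_star_mul_self hq hX'
  have hg := graph_gram hq hX hX'
  unfold graphProjection
  set c := 1 + star X * X
  set r := Ring.inverse c
  calc opTrace ((1 + X) * q * r * (1 + star X))
      = opTrace ((1 + X) * (q * q * r * (1 + star X))) := by
        rw [hq.isIdempotentElem.eq]; simp only [mul_assoc]
    _ = opTrace (q * (q * r) * (1 + star X) * (1 + X)) := by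
        rw [opTrace_mul_comm]; simp only [mul_assoc]
    _ = opTrace (q * (r * q * (1 + star X) * (1 + X))) := by
        rw [hc]; simp only [mul_assoc]
    _ = opTrace (r * (q * (1 + star X) * (1 + X) * q)) := by
        rw [opTrace_mul_comm]; simp only [mul_assoc]
    _ = opTrace q := by
        rw [hg, ← mul_assoc, ← hc, mul_assoc, Ring.inverse_mul_cancel _ hu, mul_one]

theorem graphProjection_mul (hq : IsStarProjection q) (hX : q * X = 0) (hX' : X * q = X) :
    graphProjection q X * q = (1 + X) * q * Ring.inverse (1 + star X * X) := by
  have hc := commute_inverse_one_add_star_mul_self hq hX'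
  have h2 : star X * q = 0 := by
    simpa [hq.isSelfAdjoint.star_eq] using congrArg star hX
  unfold graphProjection
  rw [mul_assoc _ _ q, add_mul (1 : H →L[ℂ] H) (star X) q, h2, one_mul, add_zero, mul_assoc _ _ q,
    ← hc, ← mul_assoc, mul_assoc _ q q, hq.isIdempotentElem.eq]

/-- The compression of the graph projection to `V` is `(1 + X*X)⁻¹`; the summand `1 - q` makes the
corner invertible on all of `H`. -/
theorem cornerOp_graphProjection_mul (hq : IsStarProjection q) (hX : q * X = 0)
    (hX' : X * q = X) :
    cornerOp q (graphProjection q X) * (q * (1 + star X * X) + (1 - q)) = 1 ∧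
      (q * (1 + star X * X) + (1 - q)) * cornerOp q (graphProjection q X) = 1 := by
  have hu := isUnit_one_add_star_mul_self X
  have hc := commute_inverse_one_add_star_mul_self hq hX'
  have hc' := commute_one_add_star_mul_self hq hX'
  have hq' := hq.isIdempotentElem.eq
  have ha : cornerOp q (graphProjection q X) = q * Ring.inverse (1 + star X * X) + (1 - q) := by
    rw [cornerOp, mul_assoc, graphProjection_mul hq hX hX', ← mul_assoc, ← mul_assoc, mul_add,
      hX, mul_one, add_zero, hq']
  rw [ha]
  set c := 1 + star X * X
  have h1 := Ring.inverse_mul_cancel _ hu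
  have h2 := Ring.mul_inverse_cancel _ hu
  set r := Ring.inverse c
  constructor
  · calc (q * r + (1 - q)) * (q * c + (1 - q))
        = q * (r * q) * c + q * r - q * (r * q) + (q * c - q * q * c) + (1 - q - q + q * q) := by
          noncomm_ring
      _ = 1 := by
          rw [← hc, ← mul_assoc, hq', mul_assoc, h1]; noncomm_ring
  · calc (q * c + (1 - q)) * (q * r + (1 - q))
        = q * (c * q) * r + q * c - q * (c * q) + (q * r - q * q * r) + (1 - q - q + q * q) := by
          noncomm_ring
      _ = 1 := by
          rw [← hc', ← mul_assoc, hq', mul_assoc, h2]; noncomm_ring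

theorem isUnit_cornerOp_graphProjection (hq : IsStarProjection q) (hX : q * X = 0)
    (hX' : X * q = X) : IsUnit (cornerOp q (graphProjection q X)) :=
  have h := cornerOp_graphProjection_mul hq hX hX'
  ⟨⟨_, _, h.1, h.2⟩, rfl⟩

theorem graphOperator_graphProjection (hq : IsStarProjection q) (hX : q * X = 0)
    (hX' : X * q = X) : graphOperator q (graphProjection q X) = X := by
  have h := cornerOp_graphProjection_mul hq hX hX'
  have hu := isUnit_one_add_star_mul_self X
  have hc' := commute_one_add_star_mul_self hq hX'
  have hq' := hq.isIdempotentElem.eq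
  have hi : Ring.inverse (cornerOp q (graphProjection q X))
      = q * (1 + star X * X) + (1 - q) :=
    Ring.inverse_unit ⟨_, _, h.1, h.2⟩
  rw [graphOperator, hi]
  calc (1 - q) * (graphProjection q X * (q * (1 + star X * X) + (1 - q))) * q
      = (1 - q) * (graphProjection q X * q) * ((1 + star X * X) * q)
        + (1 - q) * graphProjection q X * (q - q * q) := by noncomm_ring
    _ = (1 - q) * (1 + X) * q * (Ring.inverse (1 + star X * X) * (1 + star X * X)) * q := by
        rw [graphProjection_mul hq hX hX', hq']; noncomm_ring
    _ = (q - q * q) + (X * q) - (q * X) * q := by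
        rw [Ring.inverse_mul_cancel _ hu, mul_one, mul_assoc _ q q, hq']
        noncomm_ring
        rw [hq']
        abel
    _ = X := by rw [hq', hX, hX']; simp

/-- The identity `(1 + G)q = pq a⁻¹ q`, with `G` the graph operator and `a` the corner, puts the
graph of `G` inside the range of `p`. Equal traces turn the inclusion into equality. -/
theorem graphProjection_graphOperator (hq : IsStarProjection q) (hp : IsStarProjection p)
    (ht : opTrace p = opTrace q) (hu : IsUnit (cornerOp q p)) :
    graphProjection q (graphOperator q p) = p := by
  have h1 := mul_graphOperator (p := p) hq
  have h2 := graphOperator_mul (p := p) hq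
  have hq' := hq.isIdempotentElem.eq
  refine (isStarProjection_graphProjection hq h1 h2).eq_of_mul_eq_of_opTrace_eq hp ?_
    ((opTrace_graphProjection hq h1 h2).trans ht.symm)
  have key : (1 + graphOperator q p) * q = p * q * Ring.inverse (cornerOp q p) * q := by
    have hqa : q * cornerOp q p = cornerOp q p * q := by
      simp only [cornerOp]
      rw [mul_add, add_mul, mul_sub, sub_mul, mul_one, one_mul, hq', mul_assoc (q * p), hq',
        ← mul_assoc q, ← mul_assoc q, hq']
    have hqa' : q * p * q = q * cornerOp q p := by
      simp only [cornerOp]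
      rw [mul_add, ← mul_assoc, ← mul_assoc, mul_sub, mul_one, hq', sub_self, add_zero]
    have hr1 := Ring.mul_inverse_cancel _ hu
    have hr2 := Ring.inverse_mul_cancel _ hu
    have hr : q * Ring.inverse (cornerOp q p) = Ring.inverse (cornerOp q p) * q := by
      calc q * Ring.inverse (cornerOp q p)
          = Ring.inverse (cornerOp q p) * (cornerOp q p * q) * Ring.inverse (cornerOp q p) := by
            rw [← mul_assoc, hr2, one_mul]
        _ = _ := by rw [← hqa, ← mul_assoc, mul_assoc, hr1, mul_one]
    unfold graphOperator
    set a := cornerOp q p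
    set r := Ring.inverse a
    calc (1 + (1 - q) * (p * r) * q) * q
        = q + (1 - q) * p * (r * (q * q)) := by noncomm_ring
      _ = q + (1 - q) * p * (q * (r * q)) := by rw [hq', ← mul_assoc q, hr, mul_assoc r, hq']
      _ = q + p * q * r * q - (q * p * q) * r * q := by noncomm_ring
      _ = p * q * r * q := by
        rw [hqa', mul_assoc q, hr1, mul_one, hq']; abel
  unfold graphProjection
  rw [key]
  simp only [← mul_assoc]
  rw [hp.isIdempotentElem.eq]

end GraphProjection

section GraphOperator

variable {H : Type*} [NormedAddCommGroup H] [InnerProductSpace ℂ H] [CompleteSpace H]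

theorem differentiableAt_graphOperator (q : H →L[ℂ] H) {p : H →L[ℂ] H}
    (hp : IsUnit (cornerOp q p)) : DifferentiableAt ℝ (graphOperator q) p := by
  obtain ⟨u, hu⟩ := hp
  have h1 : DifferentiableAt ℝ Ring.inverse (cornerOp q p) :=
    ((hu ▸ contDiffAt_ringInverse ℝ u : ContDiffAt ℝ 1 Ring.inverse (cornerOp q p))).differentiableAt
      one_ne_zero
  have h2 : DifferentiableAt ℝ (cornerOp q) p :=
    ((differentiableAt_id.const_mul q).mul_const q).add_const _
  exact ((differentiableAt_id.mul (h1.comp p h2)).const_mul _).mul_const _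

end GraphOperator

/-! ### Charts of the Grassmannian -/

section Charts

variable {H : Type*} [NormedAddCommGroup H] [InnerProductSpace ℂ H]

/-- The operators that vanish on the kernel of the projection `q` and map its image to its
kernel. -/
def offDiagonal (q : H →L[ℂ] H) : Submodule ℂ (H →L[ℂ] H) where
  carrier := {X | q * X = 0 ∧ X * q = X}
  add_mem' := by
    rintro A B ⟨hA, hA'⟩ ⟨hB, hB'⟩
    exact ⟨by rw [mul_add, hA, hB, add_zero], by rw [add_mul, hA', hB']⟩
  zero_mem' := ⟨mul_zero _, zero_mul _⟩
  smul_mem' := by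
    rintro c A ⟨hA, hA'⟩
    exact ⟨by rw [mul_smul_comm, hA, smul_zero], by rw [smul_mul_assoc, hA']⟩

variable [FiniteDimensional ℂ H]

/-- Off-diagonal operators are the linear maps from the image to the kernel of the projection. -/
noncomputable def offDiagonalEquiv {q : H →L[ℂ] H} (hq : IsIdempotentElem q) :
    offDiagonal q ≃ₗ[ℂ]
      (LinearMap.range (q : H →ₗ[ℂ] H) →ₗ[ℂ] LinearMap.ker (q : H →ₗ[ℂ] H)) where
  toFun X := ((X.1 : H →ₗ[ℂ] H) ∘ₗ Submodule.subtype _).codRestrict _ fun v => by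
    have := congrArg (fun f : H →L[ℂ] H => f v) X.2.1
    simpa using this
  map_add' X Y := by ext v; simp
  map_smul' c X := by ext v; simp
  invFun f := ⟨LinearMap.toContinuousLinearMap
      (Submodule.subtype _ ∘ₗ f ∘ₗ (q : H →ₗ[ℂ] H).rangeRestrict), by
    constructor
    · ext v
      simp
    · ext v
      have hv : (q : H →ₗ[ℂ] H).rangeRestrict (q v) = (q : H →ₗ[ℂ] H).rangeRestrict v :=
        Subtype.ext (congrArg (fun f : H →L[ℂ] H => f v) hq)
      simp [hv]⟩
  left_inv X := by
    ext v
    exact congrArg (fun f : H →L[ℂ] H => f v) X.2.2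
  right_inv f := by
    ext v
    have hv : (q : H →ₗ[ℂ] H).rangeRestrict v = v := by
      obtain ⟨w, hw⟩ := v.2
      refine Subtype.ext ?_
      have := congrArg (fun f : H →L[ℂ] H => f w) hq
      change q v = v
      rw [← hw]
      exact this
    simp [hv]

theorem finrank_offDiagonal {q : H →L[ℂ] H} (hq : IsIdempotentElem q) {k : ℕ}
    (hk : Module.finrank ℂ (LinearMap.range (q : H →ₗ[ℂ] H)) = k) :
    Module.finrank ℂ (offDiagonal q) = k * (Module.finrank ℂ H - k) := by
  rw [(offDiagonalEquiv hq).finrank_eq, Module.finrank_linearMap, hk]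
  have := LinearMap.finrank_range_add_finrank_ker (q : H →ₗ[ℂ] H)
  rw [hk] at this
  rw [← this, Nat.add_sub_cancel_left]

/-- The retraction `r` is defined on all operators, so that the inverse of a chart lives on an open
set of operators and has an ordinary derivative there. -/
theorem exists_coordinates_offDiagonal {q : H →L[ℂ] H} (hq : IsIdempotentElem q) {k : ℕ}
    (hk : Module.finrank ℂ (LinearMap.range (q : H →ₗ[ℂ] H)) = k) :
    ∃ (i : EuclideanSpace ℝ (Fin (grassDim k H)) →L[ℝ] (H →L[ℂ] H))
      (r : (H →L[ℂ] H) →L[ℝ] EuclideanSpace ℝ (Fin (grassDim k H))),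
      (∀ x, r (i x) = x) ∧ (∀ x, i x ∈ offDiagonal q) ∧
        ∀ X ∈ offDiagonal q, i (r X) = X := by
  -- Any real isomorphism will do; only the dimension `2k(n-k)` matters.
  have e : EuclideanSpace ℝ (Fin (grassDim k H)) ≃ₗ[ℝ] offDiagonal q :=
    LinearEquiv.ofFinrankEq _ _ (by
      rw [finrank_real_of_complex, finrank_offDiagonal hq hk, finrank_euclideanSpace_fin, grassDim])
  obtain ⟨g, hg⟩ := LinearMap.exists_leftInverse_of_injective
    ((offDiagonal q).subtype.restrictScalars ℝ) (LinearMap.ker_eq_bot.2 Subtype.val_injective)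
  have hg' (X : offDiagonal q) : g X.1 = X := LinearMap.congr_fun hg X
  refine ⟨LinearMap.toContinuousLinearMap ((offDiagonal q).subtype.restrictScalars ℝ ∘ₗ e.toLinearMap),
    LinearMap.toContinuousLinearMap (e.symm.toLinearMap ∘ₗ g), ?_, fun x => (e x).2, ?_⟩
  · intro x
    change e.symm (g (e x).1) = x
    rw [hg', e.symm_apply_apply]
  · intro X hX
    change (e (e.symm (g X))).1 = X
    rw [e.apply_symm_apply, hg' ⟨X, hX⟩]

variable [CompleteSpace H]

/-- A parametrization of an open subset of the Grassmannian by a Euclidean space, with an inverse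
that is defined and smooth on an open set of operators. -/
structure GrassmannChart (k : ℕ) (H : Type*) [NormedAddCommGroup H] [InnerProductSpace ℂ H]
    [CompleteSpace H] where
  toFun : EuclideanSpace ℝ (Fin (grassDim k H)) → H →L[ℂ] H
  inv : (H →L[ℂ] H) → EuclideanSpace ℝ (Fin (grassDim k H))
  dom : Set (H →L[ℂ] H)
  isOpen_dom : IsOpen dom
  contDiff_toFun : ContDiff ℝ ∞ toFun
  mem : ∀ x, IsStarProjection (toFun x) ∧
    Module.finrank ℂ (LinearMap.range (toFun x : H →ₗ[ℂ] H)) = k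
  mem_dom : ∀ x, toFun x ∈ dom
  inv_toFun : ∀ x, inv (toFun x) = x
  differentiableAt_inv : ∀ y ∈ dom, DifferentiableAt ℝ inv y
  toFun_inv : ∀ q : ProjGrassmannian k H, q.1 ∈ dom → toFun (inv q.1) = q.1

theorem contDiff_graphProjection (q : H →L[ℂ] H) :
    ContDiff ℝ ∞ (graphProjection q) := by
  have hs : ContDiff ℝ ∞ (star : (H →L[ℂ] H) → (H →L[ℂ] H)) := (starL' ℝ).contDiff
  have hi : ContDiff ℝ ∞ fun X : H →L[ℂ] H => Ring.inverse (1 + star X * X) := by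
    refine contDiff_iff_contDiffAt.2 fun X => ?_
    obtain ⟨u, hu⟩ := isUnit_one_add_star_mul_self X
    have h1 : ContDiffAt ℝ ∞ Ring.inverse (1 + star X * X) := hu ▸ contDiffAt_ringInverse ℝ u
    exact h1.comp X (contDiff_const.add (hs.mul contDiff_id)).contDiffAt
  exact (((contDiff_const.add contDiff_id).mul contDiff_const).mul hi).mul
    (contDiff_const.add hs)

theorem exists_grassmannChart {k : ℕ} (q : ProjGrassmannian k H) :
    ∃ c : GrassmannChart k H, q.1 ∈ c.dom := by
  obtain ⟨i, r, hri, hi, hir⟩ := exists_coordinates_offDiagonal q.2.1.isIdempotentElem q.2.2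
  refine ⟨{
    toFun := fun x => graphProjection q.1 (i x)
    inv := fun p => r (graphOperator q.1 p)
    dom := {p | IsUnit (cornerOp q.1 p)}
    isOpen_dom := Units.isOpen.preimage (by unfold cornerOp; fun_prop)
    contDiff_toFun := (contDiff_graphProjection q.1).comp i.contDiff
    mem := fun x => ?_
    mem_dom := fun x => isUnit_cornerOp_graphProjection q.2.1 (hi x).1 (hi x).2
    inv_toFun := fun x => by
      rw [graphOperator_graphProjection q.2.1 (hi x).1 (hi x).2, hri]
    differentiableAt_inv := fun y hy =>
      r.differentiableAt.comp y (differentiableAt_graphOperator q.1 hy)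
    toFun_inv := fun p hp => ?_ }, ?_⟩
  · have h := isStarProjection_graphProjection q.2.1 (hi x).1 (hi x).2
    refine ⟨h, (finrank_range_eq_iff h.isIdempotentElem k).2 ?_⟩
    rw [opTrace_graphProjection q.2.1 (hi x).1 (hi x).2,
      (finrank_range_eq_iff q.2.1.isIdempotentElem k).1 q.2.2]
  · rw [hir _ ⟨mul_graphOperator q.2.1, graphOperator_mul q.2.1⟩]
    refine graphProjection_graphOperator q.2.1 p.2.1 ?_ hp
    rw [(finrank_range_eq_iff q.2.1.isIdempotentElem k).1 q.2.2,
      (finrank_range_eq_iff p.2.1.isIdempotentElem k).1 p.2.2]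
  · change IsUnit (cornerOp q.1 q.1)
    rw [cornerOp_self q.2.1]
    exact isUnit_one

end Charts

/-! ### The metric in coordinates -/

section MetricMatrix

variable {H : Type*} [NormedAddCommGroup H] [InnerProductSpace ℂ H]

/-- The Fubini-Study metric as a real bilinear map on all operators. -/
noncomputable def fubiniStudyBilin (H : Type*) [NormedAddCommGroup H] [InnerProductSpace ℂ H] :
    (H →L[ℂ] H) →ₗ[ℝ] (H →L[ℂ] H) →ₗ[ℝ] ℝ :=
  LinearMap.mk₂ ℝ fubiniStudyMetric
    (fun A B C => by simp [fubiniStudyMetric, add_mul, opTrace_add])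
    (fun c A B => by
      have : (c • A) * B = (c : ℂ) • (A * B) := by rw [← smul_mul_assoc]; rfl
      rw [fubiniStudyMetric, this, opTrace_smul, Complex.re_ofReal_mul]; rfl)
    (fun A B C => by simp [fubiniStudyMetric, mul_add, opTrace_add])
    (fun c A B => by
      have : A * (c • B) = (c : ℂ) • (A * B) := by rw [← mul_smul_comm]; rfl
      rw [fubiniStudyMetric, this, opTrace_smul, Complex.re_ofReal_mul]; rfl)

theorem fubiniStudyBilin_apply (A B : H →L[ℂ] H) :
    fubiniStudyBilin H A B = fubiniStudyMetric A B := rfl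

variable {d : ℕ}

theorem metricMatrix_eq_toMatrix₂ (φ : EuclideanSpace ℝ (Fin d) → H →L[ℂ] H)
    (x : EuclideanSpace ℝ (Fin d)) :
    metricMatrix φ x = LinearMap.toMatrix₂ (EuclideanSpace.basisFun (Fin d) ℝ).toBasis
      (EuclideanSpace.basisFun (Fin d) ℝ).toBasis
      ((fubiniStudyBilin H).compl₁₂ (fderiv ℝ φ x : EuclideanSpace ℝ (Fin d) →ₗ[ℝ] H →L[ℂ] H)
        (fderiv ℝ φ x : EuclideanSpace ℝ (Fin d) →ₗ[ℝ] H →L[ℂ] H)) := by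
  ext i j
  simp [metricMatrix, fubiniStudyBilin_apply]

/-- The chain rule makes the two metric matrices congruent through the Jacobian of `ψ`, whose
determinant therefore enters squared. -/
theorem det_metricMatrix_of_eventuallyEq_comp {φ Φ : EuclideanSpace ℝ (Fin d) → H →L[ℂ] H}
    {ψ : EuclideanSpace ℝ (Fin d) → EuclideanSpace ℝ (Fin d)} {x : EuclideanSpace ℝ (Fin d)}
    (hψ : DifferentiableAt ℝ ψ x) (hΦ : DifferentiableAt ℝ Φ (ψ x))
    (h : φ =ᶠ[nhds x] Φ ∘ ψ) :
    (metricMatrix φ x).det = (fderiv ℝ ψ x).det ^ 2 * (metricMatrix Φ (ψ x)).det := by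
  have hd : fderiv ℝ φ x = (fderiv ℝ Φ (ψ x)).comp (fderiv ℝ ψ x) := by
    rw [h.fderiv_eq, fderiv_comp x hΦ hψ]
  set b := (EuclideanSpace.basisFun (Fin d) ℝ).toBasis
  have hc : (fubiniStudyBilin H).compl₁₂ (fderiv ℝ φ x : EuclideanSpace ℝ (Fin d) →ₗ[ℝ] H →L[ℂ] H)
        (fderiv ℝ φ x : EuclideanSpace ℝ (Fin d) →ₗ[ℝ] H →L[ℂ] H)
      = ((fubiniStudyBilin H).compl₁₂
          (fderiv ℝ Φ (ψ x) : EuclideanSpace ℝ (Fin d) →ₗ[ℝ] H →L[ℂ] H)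
          (fderiv ℝ Φ (ψ x) : EuclideanSpace ℝ (Fin d) →ₗ[ℝ] H →L[ℂ] H)).compl₁₂
        (fderiv ℝ ψ x : EuclideanSpace ℝ (Fin d) →ₗ[ℝ] EuclideanSpace ℝ (Fin d))
        (fderiv ℝ ψ x : EuclideanSpace ℝ (Fin d) →ₗ[ℝ] EuclideanSpace ℝ (Fin d)) := by
    rw [hd]; rfl
  rw [metricMatrix_eq_toMatrix₂, metricMatrix_eq_toMatrix₂, hc, LinearMap.toMatrix₂_compl₁₂ b b b b,
    Matrix.det_mul, Matrix.det_mul, Matrix.det_transpose, LinearMap.det_toMatrix,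
    ContinuousLinearMap.det]
  ring

theorem continuous_sqrt_det_metricMatrix [FiniteDimensional ℂ H]
    {Φ : EuclideanSpace ℝ (Fin d) → H →L[ℂ] H} (hΦ : ContDiff ℝ ∞ Φ) :
    Continuous fun x => √(metricMatrix Φ x).det := by
  refine (Continuous.matrix_det ?_).sqrt
  refine continuous_matrix fun i j => ?_
  have h := hΦ.continuous_fderiv (by simp)
  exact Complex.continuous_re.comp (continuous_opTrace.comp
    ((h.clm_apply continuous_const).mul (h.clm_apply continuous_const)))

/-- Derivatives of a self-adjoint family are self-adjoint, so on them `Tr(AA) = Tr(A*A)` is positive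
definite, and the immersion pulls this back to a positive definite matrix. -/
theorem det_metricMatrix_pos [CompleteSpace H] [FiniteDimensional ℂ H]
    {φ : EuclideanSpace ℝ (Fin d) → H →L[ℂ] H} {x : EuclideanSpace ℝ (Fin d)}
    (hs : ∀ᶠ y in nhds x, IsSelfAdjoint (φ y)) (hφ : Function.Injective (fderiv ℝ φ x)) :
    0 < (metricMatrix φ x).det := by
  have hsa (v : EuclideanSpace ℝ (Fin d)) : star (fderiv ℝ φ x v) = fderiv ℝ φ x v := by
    have h1 : (fun y => star (φ y)) =ᶠ[nhds x] φ := hs.mono fun y hy => hy.star_eq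
    have h2 := h1.fderiv_eq (𝕜 := ℝ)
    rw [fderiv_star] at h2
    exact congrArg (fun f : EuclideanSpace ℝ (Fin d) →L[ℝ] (H →L[ℂ] H) => f v) h2
  refine Matrix.PosDef.det_pos (Matrix.PosDef.of_dotProduct_mulVec_pos ?_ fun v hv => ?_)
  · ext i j
    simp [metricMatrix, fubiniStudyMetric, opTrace_mul_comm]
  · have hd := dotProduct_toMatrix₂_mulVec (EuclideanSpace.basisFun (Fin d) ℝ).toBasis
      (EuclideanSpace.basisFun (Fin d) ℝ).toBasis
      ((fubiniStudyBilin H).compl₁₂ (fderiv ℝ φ x : EuclideanSpace ℝ (Fin d) →ₗ[ℝ] H →L[ℂ] H)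
        (fderiv ℝ φ x : EuclideanSpace ℝ (Fin d) →ₗ[ℝ] H →L[ℂ] H)) v v
    simp only [RingHom.coe_id, Function.id_comp] at hd
    rw [star_trivial, metricMatrix_eq_toMatrix₂, hd]
    set w := (EuclideanSpace.basisFun (Fin d) ℝ).toBasis.equivFun.symm v with hw
    have hw0 : w ≠ 0 := by simpa [hw] using hv
    change 0 < (opTrace (fderiv ℝ φ x w * fderiv ℝ φ x w)).re
    nth_rw 1 [← hsa w]
    refine lt_of_le_of_ne (opTrace_star_mul_self_re_nonneg _) fun h => hw0 ?_
    have := eq_zero_of_opTrace_star_mul_self h.symm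
    exact hφ (this.trans (map_zero _).symm)

end MetricMatrix

/-! ### Existence, uniqueness, finiteness and positivity of the volume -/

section Volume

variable {H : Type*} [NormedAddCommGroup H] [InnerProductSpace ℂ H] [CompleteSpace H] {k : ℕ}

namespace GrassmannChart

variable (c : GrassmannChart k H)

theorem fderiv_inv_comp_fderiv_toFun (x : EuclideanSpace ℝ (Fin (grassDim k H))) :
    (fderiv ℝ c.inv (c.toFun x)).comp (fderiv ℝ c.toFun x) = ContinuousLinearMap.id ℝ _ := by
  rw [← fderiv_comp x (c.differentiableAt_inv _ (c.mem_dom x))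
    (c.contDiff_toFun.differentiable (by simp) x)]
  have : c.inv ∘ c.toFun = id := funext c.inv_toFun
  rw [this, fderiv_id]

theorem isLocalParametrization : IsLocalParametrization k c.toFun Set.univ where
  isOpen := isOpen_univ
  smooth := c.contDiff_toFun.contDiffOn
  injOn := (Function.LeftInverse.injective c.inv_toFun).injOn
  immersion x _ := Function.LeftInverse.injective (g := fderiv ℝ c.inv (c.toFun x)) fun v =>
    congrArg (fun f : EuclideanSpace ℝ (Fin (grassDim k H)) →L[ℝ]
      EuclideanSpace ℝ (Fin (grassDim k H)) => f v) (c.fderiv_inv_comp_fderiv_toFun x)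
  mapsTo x _ := c.mem x

/-- The chart as a map to the Grassmannian. -/
def toGrass (x : EuclideanSpace ℝ (Fin (grassDim k H))) : ProjGrassmannian k H :=
  ⟨c.toFun x, c.mem x⟩

theorem continuous_toGrass : Continuous c.toGrass :=
  c.contDiff_toFun.continuous.subtype_mk _

/-- The density of the Fubini-Study volume in the chart. -/
noncomputable def density (x : EuclideanSpace ℝ (Fin (grassDim k H))) : ENNReal :=
  ENNReal.ofReal √(metricMatrix c.toFun x).det

end GrassmannChart

namespace IsLocalParametrization

variable {φ : EuclideanSpace ℝ (Fin (grassDim k H)) → H →L[ℂ] H}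
  {U s : Set (EuclideanSpace ℝ (Fin (grassDim k H)))}

theorem continuousOn (hφ : IsLocalParametrization k φ U) : ContinuousOn φ U :=
  hφ.smooth.continuousOn

theorem differentiableAt (hφ : IsLocalParametrization k φ U)
    {x : EuclideanSpace ℝ (Fin (grassDim k H))} (hx : x ∈ U) : DifferentiableAt ℝ φ x :=
  (hφ.smooth.contDiffAt (hφ.isOpen.mem_nhds hx)).differentiableAt (by simp)

/-- Lusin–Souslin: a continuous injective image of a Borel subset of a Polish space is Borel. -/
theorem measurableSet_image (hφ : IsLocalParametrization k φ U) (hs : MeasurableSet s)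
    (hsU : s ⊆ U) : MeasurableSet (φ '' s) :=
  hs.image_of_continuousOn_injOn (hφ.continuousOn.mono hsU) (hφ.injOn.mono hsU)

theorem measurableSet_inter_preimage (hφ : IsLocalParametrization k φ U) (hs : MeasurableSet s)
    (hsU : s ⊆ U) {B : Set (H →L[ℂ] H)} (hB : MeasurableSet B) : MeasurableSet (s ∩ φ ⁻¹' B) := by
  have h : Measurable (s.domRestrict φ) :=
    (continuousOn_iff_continuous_domRestrict.1 (hφ.continuousOn.mono hsU)).measurable
  have h2 := hs.subtype_image (h hB)
  rwa [Set.domRestrict_eq, Set.preimage_comp, Subtype.image_preimage_coe] at h2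

/-- The coordinate formulas for the volume in a local parametrization and in a chart agree. -/
theorem lintegral_density_eq (hφ : IsLocalParametrization k φ U) (hs : MeasurableSet s)
    (hsU : s ⊆ U) (c : GrassmannChart k H) {B : Set (H →L[ℂ] H)} (hB : MeasurableSet B)
    (hBc : B ⊆ c.dom) :
    ∫⁻ x in c.toFun ⁻¹' (φ '' s ∩ B), c.density x
      = ∫⁻ x in s ∩ φ ⁻¹' B, ENNReal.ofReal √(metricMatrix φ x).det := by
  have hinv {x} (hx : x ∈ U) (hxd : φ x ∈ c.dom) : c.toFun (c.inv (φ x)) = φ x :=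
    c.toFun_inv ⟨φ x, hφ.mapsTo x hx⟩ hxd
  have himage : c.toFun ⁻¹' (φ '' s ∩ B) = (c.inv ∘ φ) '' (s ∩ φ ⁻¹' B) := by
    ext y
    constructor
    · rintro ⟨⟨x, hx, hxy⟩, hyB⟩
      refine ⟨x, ⟨hx, ?_⟩, ?_⟩
      · rwa [Set.mem_preimage, hxy]
      · rw [Function.comp_apply, hxy, c.inv_toFun]
    · rintro ⟨x, ⟨hx, hxB⟩, rfl⟩
      rw [Set.mem_preimage, Function.comp_apply, hinv (hsU hx) (hBc hxB)]
      exact ⟨⟨x, hx, rfl⟩, hxB⟩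
  have hψd {x} (hx : x ∈ s ∩ φ ⁻¹' B) : DifferentiableAt ℝ (c.inv ∘ φ) x :=
    (c.differentiableAt_inv _ (hBc hx.2)).comp x (hφ.differentiableAt (hsU hx.1))
  have hinj : Set.InjOn (c.inv ∘ φ) (s ∩ φ ⁻¹' B) := by
    intro x hx y hy hxy
    refine hφ.injOn (hsU hx.1) (hsU hy.1) ?_
    rw [← hinv (hsU hx.1) (hBc hx.2), ← hinv (hsU hy.1) (hBc hy.2)]
    exact congrArg c.toFun hxy
  have hms := hφ.measurableSet_inter_preimage hs hsU hB
  rw [himage, lintegral_image_eq_lintegral_abs_det_fderiv_mul volume hms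
    (fun x hx => (hψd hx).hasFDerivAt.hasFDerivWithinAt) hinj]
  refine setLIntegral_congr_fun hms fun x hx => ?_
  -- Comparing derivatives at `x` needs this factorization on a neighbourhood, not just on the
  -- measurable set; it holds because `U` and the domain of the chart inverse are open.
  have hev : φ =ᶠ[nhds x] c.toFun ∘ (c.inv ∘ φ) := by
    filter_upwards [hφ.isOpen.mem_nhds (hsU hx.1),
      (hφ.differentiableAt (hsU hx.1)).continuousAt.preimage_mem_nhds (c.isOpen_dom.mem_nhds (hBc hx.2))]
      with y hy hyd
    exact (hinv hy hyd).symm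
  rw [GrassmannChart.density, ← ENNReal.ofReal_mul (abs_nonneg _),
    det_metricMatrix_of_eventuallyEq_comp (hψd hx)
      (c.contDiff_toFun.differentiable (by simp) _) hev,
    Real.sqrt_mul (sq_nonneg _), Real.sqrt_sq_eq_abs]

end IsLocalParametrization

theorem norm_le_one_of_isStarProjection {q : H →L[ℂ] H} (hq : IsStarProjection q) : ‖q‖ ≤ 1 := by
  have h : ‖q‖ * ‖q‖ = ‖q‖ := by
    rw [← CStarRing.norm_star_mul_self, hq.isSelfAdjoint.star_eq, hq.isIdempotentElem.eq]
  by_contra! h1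
  nlinarith

theorem measurableSet_setOf_mem_image {φ : EuclideanSpace ℝ (Fin (grassDim k H)) → H →L[ℂ] H}
    {U s : Set (EuclideanSpace ℝ (Fin (grassDim k H)))} (hφ : IsLocalParametrization k φ U)
    (hs : MeasurableSet s) (hsU : s ⊆ U) :
    MeasurableSet {q : ProjGrassmannian k H | q.1 ∈ φ '' s} :=
  measurable_subtype_coe (hφ.measurableSet_image hs hsU)

variable [FiniteDimensional ℂ H]

/-- The conditions `q² = q`, `q* = q`, `Tr q = k` are closed, and projections have norm at most one.
-/
theorem isCompact_setOf_projections (k : ℕ) :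
    IsCompact {q : H →L[ℂ] H | IsStarProjection q ∧
      Module.finrank ℂ (LinearMap.range (q : H →ₗ[ℂ] H)) = k} := by
  refine Metric.isCompact_of_isClosed_isBounded ?_ ?_
  · have : {q : H →L[ℂ] H | IsStarProjection q ∧
        Module.finrank ℂ (LinearMap.range (q : H →ₗ[ℂ] H)) = k}
        = {q | q * q = q} ∩ {q | star q = q} ∩ {q | opTrace q = k} := by
      ext q
      constructor
      · rintro ⟨h, h'⟩
        exact ⟨⟨h.isIdempotentElem, h.isSelfAdjoint⟩,
          (finrank_range_eq_iff h.isIdempotentElem k).1 h'⟩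
      · rintro ⟨⟨h, h'⟩, ht⟩
        exact ⟨⟨h, h'⟩, (finrank_range_eq_iff h k).2 ht⟩
    rw [this]
    exact ((isClosed_eq (by fun_prop) continuous_id).inter
      (isClosed_eq continuous_star continuous_id)).inter
      (isClosed_eq continuous_opTrace continuous_const)
  · exact (Metric.isBounded_closedBall (x := (0 : H →L[ℂ] H)) (r := 1)).subset fun q hq => by
      simpa using norm_le_one_of_isStarProjection hq.1

instance : CompactSpace (ProjGrassmannian k H) :=
  isCompact_iff_compactSpace.1 (isCompact_setOf_projections k)

/-- Compactness gives finitely many charts, and the open cover is cut into disjoint Borel pieces.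
Restricting each chart to a unit coordinate ball keeps the pieces bounded, which makes the volume
finite. -/
theorem exists_finite_atlas (k : ℕ) (H : Type*) [NormedAddCommGroup H] [InnerProductSpace ℂ H]
    [CompleteSpace H] [FiniteDimensional ℂ H] :
    ∃ (n : ℕ) (c : Fin n → GrassmannChart k H) (B : Fin n → Set (H →L[ℂ] H)),
      (∀ i, MeasurableSet (B i)) ∧ Pairwise (Function.onFun Disjoint B) ∧
      (∀ q : ProjGrassmannian k H, ∃ i, q.1 ∈ B i) ∧ (∀ i, B i ⊆ (c i).dom) ∧
      ∀ i, Bornology.IsBounded ((c i).toFun ⁻¹' B i) := by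
  choose c hc using fun q : ProjGrassmannian k H => exists_grassmannChart q
  let O (q : ProjGrassmannian k H) : Set (H →L[ℂ] H) :=
    (c q).dom ∩ (c q).inv ⁻¹' Metric.ball ((c q).inv q.1) 1
  have hO (q) : IsOpen (O q) :=
    ContinuousOn.isOpen_inter_preimage (fun y hy =>
      ((c q).differentiableAt_inv y hy).continuousAt.continuousWithinAt) (c q).isOpen_dom
      Metric.isOpen_ball
  obtain ⟨t, ht⟩ := (isCompact_univ (X := ProjGrassmannian k H)).elim_finite_subcover
    (fun q => Subtype.val ⁻¹' O q) (fun q => (hO q).preimage continuous_subtype_val)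
    (fun q _ => Set.mem_iUnion.2 ⟨q, hc q, Metric.mem_ball_self one_pos⟩)
  let e := t.equivFin.symm
  refine ⟨t.card, fun i => c (e i), disjointed fun i => O (e i), fun i => ?_,
    disjoint_disjointed _, fun q => ?_, fun i => (disjointed_subset _ i).trans fun y hy => hy.1,
    fun i => ?_⟩
  · rw [disjointed_apply, Finset.sup_set_eq_biUnion]
    exact (hO _).measurableSet.diff
      (Finset.measurableSet_biUnion _ fun j _ => (hO _).measurableSet)
  · have := ht (Set.mem_univ q)
    simp only [Set.mem_iUnion] at this
    obtain ⟨p, hp, hqp⟩ := this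
    have h : q.1 ∈ ⋃ i, O (e i) := Set.mem_iUnion.2 ⟨t.equivFin ⟨p, hp⟩, by simpa [e] using hqp⟩
    rw [← iUnion_disjointed] at h
    exact Set.mem_iUnion.1 h
  · refine (Metric.isBounded_ball (x := (c (e i)).inv (e i).1.1) (r := 1)).subset fun x hx => ?_
    have := (disjointed_subset (fun i => O (e i)) i hx).2
    rwa [Set.mem_preimage, (c (e i)).inv_toFun] at this

/-- The measure is the sum over the pieces of the pushforwards of the chart densities. In any other
parametrization each summand becomes the expected integral over a piece, and the pieces add up.
Finiteness holds because a continuous density is integrable on bounded pieces. -/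
theorem exists_isFubiniStudyVolume (k : ℕ) (H : Type*) [NormedAddCommGroup H]
    [InnerProductSpace ℂ H] [CompleteSpace H] [FiniteDimensional ℂ H] :
    ∃ vol : Measure (ProjGrassmannian k H), IsFubiniStudyVolume vol ∧ IsFiniteMeasure vol := by
  obtain ⟨n, c, B, hBm, hBd, hBu, hBc, hBb⟩ := exists_finite_atlas k H
  let vol : Measure (ProjGrassmannian k H) := ∑ i, Measure.map (c i).toGrass
    ((volume.withDensity (c i).density).restrict ((c i).toFun ⁻¹' B i))
  have hmeas (i) : MeasurableSet ((c i).toFun ⁻¹' B i) :=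
    (c i).contDiff_toFun.continuous.measurable (hBm i)
  have hvol {A : Set (H →L[ℂ] H)} (hA : MeasurableSet A) :
      vol (Subtype.val ⁻¹' A) = ∑ i, ∫⁻ x in (c i).toFun ⁻¹' (A ∩ B i), (c i).density x := by
    simp only [vol, Measure.finsetSum_apply]
    refine Finset.sum_congr rfl fun i _ => ?_
    rw [Measure.map_apply (c i).continuous_toGrass.measurable (measurable_subtype_coe hA),
      ← Set.preimage_comp, Measure.restrict_apply' (hmeas i)]
    exact withDensity_apply _ ((c i).contDiff_toFun.continuous.measurable (hA.inter (hBm i)))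
  refine ⟨vol, fun φ U hφ s hs hsU => ?_, ⟨?_⟩⟩
  · refine (hvol (hφ.measurableSet_image hs hsU)).trans ?_
    have h1 (i) := hφ.lintegral_density_eq hs hsU (c i) (hBm i) (hBc i)
    simp only [h1]
    rw [← tsum_fintype (L := .unconditional _), ← lintegral_iUnion
      (fun i => hφ.measurableSet_inter_preimage hs hsU (hBm i))]
    · congr 2
      ext x
      simp only [Set.mem_iUnion, Set.mem_inter_iff, Set.mem_preimage]
      exact ⟨fun ⟨i, hi⟩ => hi.1, fun hx =>
        (hBu ⟨φ x, hφ.mapsTo x (hsU hx)⟩).imp fun i hi => ⟨hx, hi⟩⟩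
    · intro i j hij
      exact ((hBd hij).preimage φ).mono Set.inter_subset_right Set.inter_subset_right
  · have := hvol MeasurableSet.univ
    rw [Set.preimage_univ] at this
    rw [this]
    refine ENNReal.sum_lt_top.2 fun i _ => ?_
    rw [Set.univ_inter]
    obtain ⟨R, hR⟩ := (hBb i).subset_closedBall 0
    refine (lintegral_mono_set hR).trans_lt ?_
    have hc := continuous_sqrt_det_metricMatrix (c i).contDiff_toFun
    exact (hc.continuousOn.integrableOn_compact (isCompact_closedBall 0 R)).lintegral_lt_top

/-- Within each piece of the atlas a Borel set is the image of a coordinate set, where the defining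
formula fixes its measure. -/
theorem IsFubiniStudyVolume.unique {vol vol' : Measure (ProjGrassmannian k H)}
    (h : IsFubiniStudyVolume vol) (h' : IsFubiniStudyVolume vol') : vol = vol' := by
  obtain ⟨n, c, B, hBm, hBd, hBu, hBc, -⟩ := exists_finite_atlas k H
  have key {A : Set (H →L[ℂ] H)} (hA : MeasurableSet A) (i) :
      vol (Subtype.val ⁻¹' (A ∩ B i)) = vol' (Subtype.val ⁻¹' (A ∩ B i)) := by
    have hm : MeasurableSet ((c i).toFun ⁻¹' (A ∩ B i)) :=
      (c i).contDiff_toFun.continuous.measurable (hA.inter (hBm i))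
    have he : (Subtype.val ⁻¹' (A ∩ B i) : Set (ProjGrassmannian k H))
        = {q | q.1 ∈ (c i).toFun '' ((c i).toFun ⁻¹' (A ∩ B i))} := by
      ext q
      constructor
      · intro hq
        have hi := (c i).toFun_inv q (hBc i hq.2)
        exact ⟨(c i).inv q.1, by rwa [Set.mem_preimage, hi], hi⟩
      · rintro ⟨x, hx, hxq⟩
        rw [Set.mem_preimage, ← hxq]
        exact hx
    rw [he, h _ _ (c i).isLocalParametrization _ hm (Set.subset_univ _),
      h' _ _ (c i).isLocalParametrization _ hm (Set.subset_univ _)]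
  ext S hS
  obtain ⟨A, hA, rfl⟩ := hS
  have hu : (Subtype.val ⁻¹' A : Set (ProjGrassmannian k H))
      = ⋃ i, Subtype.val ⁻¹' (A ∩ B i) := by
    ext q
    simp only [Set.mem_iUnion, Set.mem_inter_iff, Set.mem_preimage]
    exact ⟨fun hq => (hBu q).imp fun i hi => ⟨hq, hi⟩, fun ⟨i, hi⟩ => hi.1⟩
  have hd : Pairwise (Function.onFun Disjoint
      fun i => (Subtype.val ⁻¹' (A ∩ B i) : Set (ProjGrassmannian k H))) := fun i j hij =>
    ((hBd hij).mono Set.inter_subset_right Set.inter_subset_right).preimage _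
  have hm (i) : MeasurableSet (Subtype.val ⁻¹' (A ∩ B i) : Set (ProjGrassmannian k H)) :=
    measurable_subtype_coe (hA.inter (hBm i))
  rw [hu, measure_iUnion hd hm, measure_iUnion hd hm]
  exact tsum_congr fun i => key hA i

theorem IsFubiniStudyVolume.isFiniteMeasure {vol : Measure (ProjGrassmannian k H)}
    (h : IsFubiniStudyVolume vol) : IsFiniteMeasure vol := by
  obtain ⟨vol', h', hf⟩ := exists_isFubiniStudyVolume k H
  rwa [h.unique h']

/-- Otherwise the density of a chart would vanish almost everywhere, yet it is strictly positive. -/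
theorem IsFubiniStudyVolume.univ_ne_zero {vol : Measure (ProjGrassmannian k H)}
    (h : IsFubiniStudyVolume vol) [Nonempty (ProjGrassmannian k H)] : vol Set.univ ≠ 0 := by
  obtain ⟨c, -⟩ := exists_grassmannChart (Classical.arbitrary (ProjGrassmannian k H))
  have h1 := h _ _ c.isLocalParametrization _ MeasurableSet.univ subset_rfl
  refine fun h0 => ?_
  rw [measure_mono_null (Set.subset_univ _) h0, Measure.restrict_univ] at h1
  have hm : Measurable c.density :=
    (continuous_sqrt_det_metricMatrix c.contDiff_toFun).measurable.ennreal_ofReal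
  have h2 := (lintegral_eq_zero_iff hm).1 h1.symm
  obtain ⟨x, hx⟩ := h2.exists
  have h3 := det_metricMatrix_pos (x := x) (Filter.Eventually.of_forall fun y =>
    (c.mem y).1.isSelfAdjoint) (c.isLocalParametrization.immersion x (Set.mem_univ x))
  rw [GrassmannChart.density, Pi.zero_apply, ENNReal.ofReal_eq_zero] at hx
  exact absurd hx (not_le.2 (Real.sqrt_pos.2 h3))

end Volume

/-! ### Unitary invariance of the volume -/

section Invariance

variable {H : Type*} [NormedAddCommGroup H] [InnerProductSpace ℂ H] [CompleteSpace H]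
  {u : H →L[ℂ] H}

theorem IsStarProjection.unitary_conj (hu : u ∈ unitary (H →L[ℂ] H)) {q : H →L[ℂ] H}
    (hq : IsStarProjection q) : IsStarProjection (u * q * star u) := by
  refine ⟨?_, ?_⟩
  · calc u * q * star u * (u * q * star u) = u * q * (star u * u) * q * star u := by
          simp only [mul_assoc]
      _ = u * q * star u := by
          rw [Unitary.star_mul_self_of_mem hu, mul_one, mul_assoc u, hq.isIdempotentElem.eq]
  · rw [isSelfAdjoint_iff]
    simp [hq.isSelfAdjoint.star_eq, mul_assoc]

theorem opTrace_unitary_conj (hu : u ∈ unitary (H →L[ℂ] H)) (A : H →L[ℂ] H) :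
    opTrace (u * A * star u) = opTrace A := by
  rw [opTrace_mul_comm, ← mul_assoc, Unitary.star_mul_self_of_mem hu, one_mul]

variable {k : ℕ}

theorem hasFDerivAt_unitary_conj {d : ℕ} {φ : EuclideanSpace ℝ (Fin d) → H →L[ℂ] H}
    {x : EuclideanSpace ℝ (Fin d)} (hφ : DifferentiableAt ℝ φ x) (u : H →L[ℂ] H) :
    HasFDerivAt (fun x => u * φ x * star u)
      ((ContinuousLinearMap.mulLeftRight ℝ (H →L[ℂ] H) u (star u)).comp (fderiv ℝ φ x)) x :=
  (ContinuousLinearMap.mulLeftRight ℝ (H →L[ℂ] H) u (star u)).hasFDerivAt.comp x hφ.hasFDerivAt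

theorem injective_unitary_conj (hu : u ∈ unitary (H →L[ℂ] H)) :
    Function.Injective fun A : H →L[ℂ] H => u * A * star u :=
  Function.LeftInverse.injective (g := fun A => star u * A * u) fun A => by
    calc star u * (u * A * star u) * u = star u * u * A * (star u * u) := by
          simp only [mul_assoc]
      _ = A := by rw [Unitary.star_mul_self_of_mem hu, one_mul, mul_one]

theorem metricMatrix_unitary_conj (hu : u ∈ unitary (H →L[ℂ] H)) {d : ℕ}
    {φ : EuclideanSpace ℝ (Fin d) → H →L[ℂ] H} {x : EuclideanSpace ℝ (Fin d)}
    (hφ : DifferentiableAt ℝ φ x) :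
    metricMatrix (fun x => u * φ x * star u) x = metricMatrix φ x := by
  ext i j
  have h (A B : H →L[ℂ] H) : u * A * star u * (u * B * star u) = u * (A * B) * star u := by
    calc _ = u * A * (star u * u) * B * star u := by simp only [mul_assoc]
      _ = _ := by rw [Unitary.star_mul_self_of_mem hu, mul_one]; simp only [mul_assoc]
  simp [metricMatrix, fubiniStudyMetric, (hasFDerivAt_unitary_conj hφ u).fderiv, h,
    opTrace_unitary_conj hu]

variable [FiniteDimensional ℂ H]

theorem finrank_range_unitary_conj (hu : u ∈ unitary (H →L[ℂ] H)) {q : H →L[ℂ] H}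
    (hq : IsStarProjection q) (hk : Module.finrank ℂ (LinearMap.range (q : H →ₗ[ℂ] H)) = k) :
    Module.finrank ℂ (LinearMap.range ((u * q * star u : H →L[ℂ] H) : H →ₗ[ℂ] H)) = k := by
  rw [finrank_range_eq_iff (hq.unitary_conj hu).isIdempotentElem, opTrace_unitary_conj hu,
    ← finrank_range_eq_iff hq.isIdempotentElem, hk]

/-- The action of a unitary operator on the Grassmannian. -/
noncomputable def grassConj (hu : u ∈ unitary (H →L[ℂ] H)) (q : ProjGrassmannian k H) :
    ProjGrassmannian k H :=
  ⟨u * q.1 * star u, q.2.1.unitary_conj hu, finrank_range_unitary_conj hu q.2.1 q.2.2⟩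

theorem continuous_grassConj (hu : u ∈ unitary (H →L[ℂ] H)) :
    Continuous (grassConj hu : ProjGrassmannian k H → ProjGrassmannian k H) :=
  Continuous.subtype_mk (by fun_prop) _

theorem IsLocalParametrization.unitary_conj (hu : u ∈ unitary (H →L[ℂ] H))
    {φ : EuclideanSpace ℝ (Fin (grassDim k H)) → H →L[ℂ] H}
    {U : Set (EuclideanSpace ℝ (Fin (grassDim k H)))} (hφ : IsLocalParametrization k φ U) :
    IsLocalParametrization k (fun x => u * φ x * star u) U where
  isOpen := hφ.isOpen
  smooth := (ContinuousLinearMap.mulLeftRight ℝ (H →L[ℂ] H) u (star u)).contDiff.comp_contDiffOn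
    hφ.smooth
  injOn := fun _ hx _ hy h => hφ.injOn hx hy (injective_unitary_conj hu h)
  immersion x hx := by
    rw [(hasFDerivAt_unitary_conj (hφ.differentiableAt hx) u).fderiv]
    exact (injective_unitary_conj hu).comp (hφ.immersion x hx)
  mapsTo x hx := ⟨(hφ.mapsTo x hx).1.unitary_conj hu,
    finrank_range_unitary_conj hu (hφ.mapsTo x hx).1 (hφ.mapsTo x hx).2⟩

/-- Conjugation carries parametrizations to parametrizations with the same metric matrix, so the
pushforward also satisfies the defining formula; uniqueness concludes. -/
theorem IsFubiniStudyVolume.map_grassConj (hu : u ∈ unitary (H →L[ℂ] H))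
    {vol : Measure (ProjGrassmannian k H)} (h : IsFubiniStudyVolume vol) :
    vol.map (grassConj hu) = vol := by
  refine IsFubiniStudyVolume.unique (fun φ U hφ s hs hsU => ?_) h
  have hu' : star u ∈ unitary (H →L[ℂ] H) := Unitary.star_mem hu
  rw [Measure.map_apply (continuous_grassConj hu).measurable
    (measurableSet_setOf_mem_image hφ hs hsU)]
  have he : grassConj hu ⁻¹' {q : ProjGrassmannian k H | q.1 ∈ φ '' s}
      = {q | q.1 ∈ (fun x => star u * φ x * star (star u)) '' s} := by
    ext q
    constructor
    · rintro ⟨x, hx, hxq⟩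
      refine ⟨x, hx, ?_⟩
      dsimp only
      rw [hxq]
      calc star u * (u * q.1 * star u) * star (star u)
          = star u * u * q.1 * (star u * u) := by simp only [mul_assoc, star_star]
        _ = q.1 := by rw [Unitary.star_mul_self_of_mem hu, one_mul, mul_one]
    · rintro ⟨x, hx, hxq⟩
      refine ⟨x, hx, ?_⟩
      change φ x = u * q.1 * star u
      rw [← hxq]
      calc φ x = u * star u * φ x * (u * star u) := by
            rw [Unitary.mul_star_self_of_mem hu, one_mul, mul_one]
        _ = _ := by simp only [mul_assoc, star_star]
  rw [he, h _ _ (hφ.unitary_conj hu') _ hs hsU]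
  refine setLIntegral_congr_fun hs fun x hx => ?_
  rw [metricMatrix_unitary_conj hu' (hφ.differentiableAt (hsU hx))]

theorem IsFubiniStudyVolume.integral_grassConj (hu : u ∈ unitary (H →L[ℂ] H))
    {vol : Measure (ProjGrassmannian k H)} (h : IsFubiniStudyVolume vol)
    {f : ProjGrassmannian k H → H →L[ℂ] H} (hf : Continuous f) :
    ∫ q, f (grassConj hu q) ∂vol = ∫ q, f q ∂vol := by
  conv_rhs => rw [← h.map_grassConj hu]
  exact (integral_map (continuous_grassConj hu).aemeasurable hf.aestronglyMeasurable).symm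

end Invariance

/-! ### Reflections, transitivity on frames, polarization -/

section Unitaries

variable {H : Type*} [NormedAddCommGroup H] [InnerProductSpace ℂ H]

/-- The line through `x` is the `-1` eigenspace of the reflection, so a commuting operator preserves
it. -/
theorem apply_eq_inner_smul_of_commute_reflection {x : H} (hx : ‖x‖ = 1) {C : H →L[ℂ] H}
    (h : (1 - (2 : ℂ) • InnerProductSpace.rankOne ℂ x x) * C
      = C * (1 - (2 : ℂ) • InnerProductSpace.rankOne ℂ x x)) :
    C x = inner ℂ x (C x) • x := by
  have h1 := congrArg (fun f : H →L[ℂ] H => f x) h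
  have hxx : inner ℂ x x = (1 : ℂ) := by simp [inner_self_eq_norm_sq_to_K, hx]
  simp only [mul_apply_eq_comp, sub_apply,
    one_apply_eq_self, smul_apply,
    InnerProductSpace.rankOne_apply, hxx, one_smul, map_sub, map_smul] at h1
  have h2 : (2 : ℂ) • C x = (2 : ℂ) • (inner ℂ x (C x) • x) := by
    rw [sub_eq_sub_iff_add_eq_add, ← sub_eq_iff_eq_add] at h1
    rw [two_smul]
    rw [sub_eq_iff_eq_add] at h1
    have h3 : C x + (2 : ℂ) • C x = C x + (2 : ℂ) • (inner ℂ x (C x) • x) := h1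
    rw [← two_smul ℂ (C x)]
    exact add_left_cancel h3
  exact smul_right_injective H (two_ne_zero (α := ℂ)) h2

variable [CompleteSpace H]

theorem reflection_mem_unitary {x : H} (hx : ‖x‖ = 1) :
    1 - (2 : ℂ) • InnerProductSpace.rankOne ℂ x x ∈ unitary (H →L[ℂ] H) := by
  have h1 : star (InnerProductSpace.rankOne ℂ x x) = InnerProductSpace.rankOne ℂ x x := by
    rw [ContinuousLinearMap.star_eq_adjoint, InnerProductSpace.adjoint_rankOne]
  have h2 : InnerProductSpace.rankOne ℂ x x * InnerProductSpace.rankOne ℂ x x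
      = InnerProductSpace.rankOne ℂ x x := InnerProductSpace.isIdempotentElem_rankOne_self hx
  have h3 : star (1 - (2 : ℂ) • InnerProductSpace.rankOne ℂ x x)
      = 1 - (2 : ℂ) • InnerProductSpace.rankOne ℂ x x := by
    rw [star_sub, star_smul, h1]; simp
  have h4 : (1 - (2 : ℂ) • InnerProductSpace.rankOne ℂ x x)
      * (1 - (2 : ℂ) • InnerProductSpace.rankOne ℂ x x) = 1 := by
    rw [sub_mul, mul_sub, mul_sub, smul_mul_smul_comm, h2, mul_one, mul_one, one_mul]
    module
  rw [Unitary.mem_iff, h3]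
  exact ⟨h4, h4⟩

theorem unitary_mul_rankOne_mul (u : H →L[ℂ] H) (x y : H) :
    u * InnerProductSpace.rankOne ℂ x y * star u = InnerProductSpace.rankOne ℂ (u x) (u y) := by
  rw [ContinuousLinearMap.mul_def, ContinuousLinearMap.mul_def,
    InnerProductSpace.comp_rankOne, InnerProductSpace.rankOne_comp,
    ContinuousLinearMap.star_eq_adjoint, ContinuousLinearMap.adjoint_adjoint]

theorem inner_unitary_apply {u : H →L[ℂ] H} (hu : u ∈ unitary (H →L[ℂ] H)) (x y : H) :
    inner ℂ (u x) (u y) = inner ℂ x y := by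
  rw [← ContinuousLinearMap.adjoint_inner_right, ← ContinuousLinearMap.star_eq_adjoint,
    ← mul_apply_eq_comp, Unitary.star_mul_self_of_mem hu,
    one_apply_eq_self]

theorem inner_unitary_conj_apply {u : H →L[ℂ] H} (hu : u ∈ unitary (H →L[ℂ] H)) (C : H →L[ℂ] H)
    (x y : H) : inner ℂ (u x) ((u * C * star u) (u y)) = inner ℂ x (C y) := by
  have : (u * C * star u) (u y) = u (C ((star u * u) y)) := rfl
  rw [this, Unitary.star_mul_self_of_mem hu, one_apply_eq_self,
    inner_unitary_apply hu]

variable [FiniteDimensional ℂ H]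

/-- Both frames extend to orthonormal bases, and the unitary matches these. -/
theorem exists_unitary_of_orthonormal {m : ℕ} {v w : Fin m → H} (hv : Orthonormal ℂ v)
    (hw : Orthonormal ℂ w) : ∃ u ∈ unitary (H →L[ℂ] H), ∀ i, u (v i) = w i := by
  have hm : m ≤ Module.finrank ℂ H := by
    simpa using hv.linearIndependent.fintype_card_le_finrank
  have ext {v : Fin m → H} (hv : Orthonormal ℂ v) :
      ∃ b : OrthonormalBasis (Fin (Module.finrank ℂ H)) ℂ H, ∀ i, b (Fin.castLE hm i) = v i := by
    have hf := Fin.castLE_injective hm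
    have ho : Orthonormal ℂ ((Set.range (Fin.castLE hm)).domRestrict
        (Function.extend (Fin.castLE hm) v 0)) := by
      have : (Set.range (Fin.castLE hm)).domRestrict (Function.extend (Fin.castLE hm) v 0)
          = v ∘ (Equiv.ofInjective _ hf).symm := by
        ext ⟨_, i, rfl⟩
        simp [hf.extend_apply]
      rw [this]
      exact hv.comp _ (Equiv.injective _)
    obtain ⟨b, hb⟩ := ho.exists_orthonormalBasis_extension_of_card_eq (by simp)
    exact ⟨b, fun i => by rw [hb _ ⟨i, rfl⟩, hf.extend_apply]⟩
  obtain ⟨b, hb⟩ := ext hv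
  obtain ⟨c, hc⟩ := ext hw
  let e := Unitary.linearIsometryEquiv.symm (b.equiv c (Equiv.refl _))
  refine ⟨e.1, e.2, fun i => ?_⟩
  have : e.1 (v i) = b.equiv c (Equiv.refl _) (v i) := by simp [e]
  rw [this, ← hb, ← hc, OrthonormalBasis.equiv_apply_basis, Equiv.refl_apply]

/-- Polarization with `x + y` and `x + iy`: `rankOne` is conjugate-linear in its second argument, so
the two identities separate `D(|x⟩⟨y|)` from `D(|y⟩⟨x|)`. Rank-one operators span. -/
theorem linearMap_eq_zero_of_rankOne_self (D : (H →L[ℂ] H) →ₗ[ℂ] (H →L[ℂ] H))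
    (hD : ∀ x, D (InnerProductSpace.rankOne ℂ x x) = 0) : D = 0 := by
  have h1 (x y : H) : D (InnerProductSpace.rankOne ℂ x y)
      + D (InnerProductSpace.rankOne ℂ y x) = 0 := by
    have := hD (x + y)
    simpa [hD] using this
  have h2 (x y : H) : D (InnerProductSpace.rankOne ℂ x y) = 0 := by
    have h3 := h1 x (Complex.I • y)
    simp only [map_smulₛₗ, smul_apply, Complex.conj_I,
      RingHom.id_apply] at h3
    have h4 := h1 x y
    have h5 : (2 * Complex.I) • D (InnerProductSpace.rankOne ℂ x y) = 0 := by
      rw [← eq_neg_iff_add_eq_zero] at h4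
      rw [h4] at h3 ⊢
      rw [← neg_eq_zero, ← h3]
      module
    exact (smul_eq_zero.1 h5).resolve_left (by simp)
  ext1 M
  have hM : M = ∑ i, InnerProductSpace.rankOne ℂ (M (stdOrthonormalBasis ℂ H i))
      (stdOrthonormalBasis ℂ H i) := by
    ext x
    simp only [sum_apply, InnerProductSpace.rankOne_apply]
    conv_lhs => rw [← (stdOrthonormalBasis ℂ H).sum_repr' x]
    simp
  rw [hM, map_sum]
  simp [h2]

end Unitaries

/-! ### The averaged compression and the constant -/

section Compression

open InnerProductSpace

variable {H : Type*} [NormedAddCommGroup H] [InnerProductSpace ℂ H] [CompleteSpace H]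
  [FiniteDimensional ℂ H] {k : ℕ} {vol : Measure (ProjGrassmannian k H)}

theorem IsFubiniStudyVolume.integrable (h : IsFubiniStudyVolume vol) {F : Type*}
    [NormedAddCommGroup F] {f : ProjGrassmannian k H → F} (hf : Continuous f) :
    Integrable f vol :=
  haveI := h.isFiniteMeasure
  hf.integrable_of_hasCompactSupport (HasCompactSupport.of_compactSpace f)

/-- The average of the compressions `M ↦ qMq` over the Grassmannian. -/
noncomputable def averageCompression (vol : Measure (ProjGrassmannian k H)) :
    (H →L[ℂ] H) →L[ℂ] (H →L[ℂ] H) :=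
  ∫ q, ContinuousLinearMap.mulLeftRight ℂ (H →L[ℂ] H) q.1 q.1 ∂vol

theorem averageCompression_apply (h : IsFubiniStudyVolume vol) (M : H →L[ℂ] H) :
    averageCompression vol M = ∫ q, q.1 * M * q.1 ∂vol := by
  rw [averageCompression, ContinuousLinearMap.integral_apply]
  · rfl
  · exact h.integrable (by fun_prop)

theorem unitary_conj_averageCompression (h : IsFubiniStudyVolume vol) {u : H →L[ℂ] H}
    (hu : u ∈ unitary (H →L[ℂ] H)) (M : H →L[ℂ] H) :
    averageCompression vol (u * M * star u) = u * averageCompression vol M * star u := by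
  rw [averageCompression_apply h, averageCompression_apply h,
    ← h.integral_grassConj hu (by fun_prop)]
  have h1 (q : ProjGrassmannian k H) :
      (grassConj hu q).1 * (u * M * star u) * (grassConj hu q).1
        = ContinuousLinearMap.mulLeftRight ℂ (H →L[ℂ] H) u (star u) (q.1 * M * q.1) := by
    change u * q.1 * star u * (u * M * star u) * (u * q.1 * star u)
      = u * (q.1 * M * q.1) * star u
    calc _ = u * q.1 * (star u * u) * M * (star u * u) * q.1 * star u := by
          simp only [mul_assoc]
      _ = _ := by
          rw [Unitary.star_mul_self_of_mem hu, mul_one, mul_one]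
          simp only [mul_assoc]
  simp only [h1]
  rw [ContinuousLinearMap.integral_comp_comm _ (h.integrable (by fun_prop))]
  rfl

/-- By equivariance the image of `|x⟩⟨x|` commutes with the stabilizer of `|x⟩⟨x|`. The reflections
in `x` and in vectors orthogonal to `x` lie there, and make all these vectors eigenvectors. -/
theorem averageCompression_commute (h : IsFubiniStudyVolume vol) {u : H →L[ℂ] H}
    (hu : u ∈ unitary (H →L[ℂ] H)) {x : H} (hx : rankOne ℂ (u x) (u x) = rankOne ℂ x x) :
    u * averageCompression vol (rankOne ℂ x x) = averageCompression vol (rankOne ℂ x x) * u := by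
  have h1 := unitary_conj_averageCompression h hu (rankOne ℂ x x)
  rw [unitary_mul_rankOne_mul, hx] at h1
  conv_rhs => rw [h1]
  rw [mul_assoc _ (star u), Unitary.star_mul_self_of_mem hu, mul_one]

theorem inner_averageCompression_unitary (h : IsFubiniStudyVolume vol) {u : H →L[ℂ] H}
    (hu : u ∈ unitary (H →L[ℂ] H)) (x y : H) :
    inner ℂ (u y) (averageCompression vol (rankOne ℂ (u x) (u x)) (u y))
      = inner ℂ y (averageCompression vol (rankOne ℂ x x) y) := by
  rw [← unitary_mul_rankOne_mul, unitary_conj_averageCompression h hu,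
    inner_unitary_conj_apply hu]

theorem averageCompression_rankOne_self_apply_self (h : IsFubiniStudyVolume vol) {x : H}
    (hx : ‖x‖ = 1) : averageCompression vol (rankOne ℂ x x) x
      = inner ℂ x (averageCompression vol (rankOne ℂ x x) x) • x := by
  refine apply_eq_inner_smul_of_commute_reflection hx
    (averageCompression_commute h (reflection_mem_unitary hx) ?_)
  have : (1 - (2 : ℂ) • rankOne ℂ x x) x = -x := by
    simp only [sub_apply, one_apply_eq_self, smul_apply, rankOne_apply,
      inner_self_eq_norm_sq_to_K, hx]
    simp only [RCLike.ofReal_one, one_pow, one_smul]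
    module
  rw [this]
  simp

theorem averageCompression_rankOne_self_apply_of_inner_eq_zero (h : IsFubiniStudyVolume vol)
    {x y : H} (hy : ‖y‖ = 1) (hxy : inner ℂ y x = 0) :
    averageCompression vol (rankOne ℂ x x) y
      = inner ℂ y (averageCompression vol (rankOne ℂ x x) y) • y := by
  refine apply_eq_inner_smul_of_commute_reflection hy
    (averageCompression_commute h (reflection_mem_unitary hy) ?_)
  have : (1 - (2 : ℂ) • rankOne ℂ y y) x = x := by simp [hxy]
  rw [this]

/-- For unit `x` the image of `|x⟩⟨x|` has `x` and every `y ⊥ x` as eigenvectors. Transitivity of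
the unitary group on orthonormal pairs makes the two eigenvalues independent of `x` and `y`; other
`x` follow by scaling. -/
theorem exists_averageCompression_rankOne_self (h : IsFubiniStudyVolume vol)
    (hn : 2 ≤ Module.finrank ℂ H) :
    ∃ a b : ℂ, ∀ x : H, averageCompression vol (rankOne ℂ x x)
      = a • rankOne ℂ x x + (b * inner ℂ x x) • (1 : H →L[ℂ] H) := by
  let e := stdOrthonormalBasis ℂ H
  let v : Fin 2 → H := e ∘ Fin.castLE hn
  have hv : Orthonormal ℂ v := e.orthonormal.comp _ (Fin.castLE_injective hn)
  -- The two eigenvalues are read off one fixed orthonormal pair, which exists since the dimension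
  -- is at least two. The coefficient of `rankOne ℂ x x` will be `g - b`.
  set b := inner ℂ (v 1) (averageCompression vol (rankOne ℂ (v 0) (v 0)) (v 1)) with hb
  set g := inner ℂ (v 0) (averageCompression vol (rankOne ℂ (v 0) (v 0)) (v 0)) with hg
  have hself {x : H} (hx : ‖x‖ = 1) : averageCompression vol (rankOne ℂ x x) x = g • x := by
    have h1 : Orthonormal ℂ ![v 0] := by simpa using hv.1 0
    have h2 : Orthonormal ℂ ![x] := by simpa using hx
    obtain ⟨u, hu, huv⟩ := exists_unitary_of_orthonormal h1 h2
    have h3 : u (v 0) = x := huv 0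
    rw [averageCompression_rankOne_self_apply_self h hx, ← h3,
      inner_averageCompression_unitary h hu]
  have hperp {x y : H} (hx : ‖x‖ = 1) (hxy : inner ℂ x y = 0) :
      averageCompression vol (rankOne ℂ x x) y = b • y := by
    have hunit {y : H} (hy : ‖y‖ = 1) (hxy : inner ℂ x y = 0) :
        averageCompression vol (rankOne ℂ x x) y = b • y := by
      have h2 : Orthonormal ℂ ![x, y] := by
        simp [hx, hy, hxy]
      obtain ⟨u, hu, huv⟩ := exists_unitary_of_orthonormal hv h2
      have h3 : u (v 0) = x := huv 0
      have h4 : u (v 1) = y := huv 1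
      rw [averageCompression_rankOne_self_apply_of_inner_eq_zero h hy
        (inner_eq_zero_symm.1 hxy), ← h3, ← h4, inner_averageCompression_unitary h hu]
    by_cases hy : y = 0
    · simp [hy]
    · have h1 := hunit (y := ((‖y‖ : ℂ)⁻¹) • y) (norm_smul_inv_norm hy)
        (by rw [inner_smul_right, hxy, mul_zero])
      rw [map_smul, smul_comm] at h1
      exact smul_right_injective H (inv_ne_zero (by simpa using hy)) h1
  have hone {x : H} (hx : ‖x‖ = 1) : averageCompression vol (rankOne ℂ x x)
      = (g - b) • rankOne ℂ x x + b • (1 : H →L[ℂ] H) := by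
    ext z
    have hxx : inner ℂ x x = (1 : ℂ) := by simp [inner_self_eq_norm_sq_to_K, hx]
    have hz : z = inner ℂ x z • x + (z - inner ℂ x z • x) := by abel
    have h1 : averageCompression vol (rankOne ℂ x x) z
        = inner ℂ x z • g • x + b • (z - inner ℂ x z • x) := by
      conv_lhs => rw [hz]
      rw [map_add, map_smul, hself hx, hperp hx]
      rw [inner_sub_right, inner_smul_right, hxx, mul_one, sub_self]
    rw [h1]
    simp only [add_apply, smul_apply, rankOne_apply, one_apply_eq_self]
    module
  refine ⟨g - b, b, fun x => ?_⟩
  by_cases hx : x = 0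
  · simp [hx]
  · have hx0 : (‖x‖ : ℂ) ≠ 0 := by simpa using hx
    have h1 := hone (norm_smul_inv_norm (𝕜 := ℂ) hx)
    have h2 : rankOne ℂ ((‖x‖ : ℂ)⁻¹ • x) ((‖x‖ : ℂ)⁻¹ • x) = ((‖x‖ : ℂ) ^ 2)⁻¹ • rankOne ℂ x x := by
      ext z
      simp [rankOne_apply, smul_smul]
      ring_nf
    have h3 : rankOne ℂ x x = (‖x‖ : ℂ) ^ 2 • rankOne ℂ ((‖x‖ : ℂ)⁻¹ • x) ((‖x‖ : ℂ)⁻¹ • x) := by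
      rw [h2, smul_smul, mul_inv_cancel₀ (pow_ne_zero 2 hx0), one_smul]
    rw [h3, map_smul]
    have h4 : averageCompression vol (rankOne ℂ ((‖x‖ : ℂ)⁻¹ • x) ((‖x‖ : ℂ)⁻¹ • x)) = _ := h1
    rw [h4, inner_self_eq_norm_sq_to_K]
    simp only [smul_add, smul_smul, Complex.coe_algebraMap]
    congr 2 <;> ring

theorem exists_averageCompression_eq (h : IsFubiniStudyVolume vol)
    (hn : 2 ≤ Module.finrank ℂ H) :
    ∃ a b : ℂ, ∀ M : H →L[ℂ] H, averageCompression vol M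
      = a • M + (b * opTrace M) • (1 : H →L[ℂ] H) := by
  obtain ⟨a, b, hab⟩ := exists_averageCompression_rankOne_self h hn
  refine ⟨a, b, fun M => ?_⟩
  have h1 := linearMap_eq_zero_of_rankOne_self
    ((averageCompression vol : (H →L[ℂ] H) →ₗ[ℂ] (H →L[ℂ] H)) - a • LinearMap.id
      - b • (LinearMap.trace ℂ H ∘ₗ ContinuousLinearMap.coeLM ℂ).smulRight (1 : H →L[ℂ] H))
    (fun x => by simp [hab, trace_rankOne, smul_smul])
  have h2 := LinearMap.congr_fun h1 M
  simp only [LinearMap.sub_apply, LinearMap.smul_apply, LinearMap.id_apply,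
    LinearMap.zero_apply, ContinuousLinearMap.coe_coe, LinearMap.smulRight_apply,
    LinearMap.comp_apply, smul_smul] at h2
  rw [sub_sub, sub_eq_zero] at h2
  exact h2

theorem integral_opTrace (h : IsFubiniStudyVolume vol) :
    opTrace (∫ q, q.1 ∂vol) = k * (vol.real Set.univ : ℂ) := by
  let t : (H →L[ℂ] H) →L[ℂ] ℂ :=
    ⟨LinearMap.trace ℂ H ∘ₗ ContinuousLinearMap.coeLM ℂ, continuous_opTrace⟩
  change t _ = _
  rw [← t.integral_comp_comm (h.integrable continuous_subtype_val)]
  have h1 (q : ProjGrassmannian k H) : t q.1 = k :=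
    (finrank_range_eq_iff q.2.1.isIdempotentElem k).1 q.2.2
  simp only [h1, integral_const, Complex.real_smul]
  ring

/-- Each term is `∫ ⟨eᵢ, q eᵢ⟩⟨eⱼ, q eⱼ⟩`, so the double sum is `∫ (Tr q)²`. This is the second
equation for `a` and `b`. -/
theorem sum_inner_averageCompression (h : IsFubiniStudyVolume vol) {ι : Type*} [Fintype ι]
    (e : OrthonormalBasis ι ℂ H) :
    ∑ i, ∑ j, inner ℂ (e i) (averageCompression vol (rankOne ℂ (e i) (e j)) (e j))
      = k ^ 2 * (vol.real Set.univ : ℂ) := by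
  have h1 (i j) : inner ℂ (e i) (averageCompression vol (rankOne ℂ (e i) (e j)) (e j))
      = ∫ q : ProjGrassmannian k H, inner ℂ (e i) (q.1 (e i)) * inner ℂ (e j) (q.1 (e j)) ∂vol := by
    rw [averageCompression_apply h, ContinuousLinearMap.integral_apply (h.integrable (by fun_prop)),
      ← integral_inner (h.integrable (by fun_prop))]
    refine integral_congr_ae (Filter.Eventually.of_forall fun q => ?_)
    simp [inner_smul_right, mul_comm]
  have hc (i) : Continuous fun q : ProjGrassmannian k H => inner ℂ (e i) (q.1 (e i)) := by
    fun_prop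
  have h3 (i) : ∑ j, ∫ q : ProjGrassmannian k H,
        inner ℂ (e i) (q.1 (e i)) * inner ℂ (e j) (q.1 (e j)) ∂vol
      = ∫ q : ProjGrassmannian k H,
        ∑ j, inner ℂ (e i) (q.1 (e i)) * inner ℂ (e j) (q.1 (e j)) ∂vol :=
    (integral_finsetSum _ fun j _ => h.integrable ((hc i).mul (hc j))).symm
  simp only [h1, h3]
  refine (integral_finsetSum _ fun i _ => h.integrable
    (continuous_finsetSum _ fun j _ => (hc i).mul (hc j))).symm.trans ?_
  have h2 (q : ProjGrassmannian k H) :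
      ∑ i, ∑ j, inner ℂ (e i) (q.1 (e i)) * inner ℂ (e j) (q.1 (e j)) = (k : ℂ) ^ 2 := by
    rw [← Finset.sum_mul_sum, ← (finrank_range_eq_iff q.2.1.isIdempotentElem k).1 q.2.2, opTrace,
      LinearMap.trace_eq_sum_inner _ e, sq]
    rfl
  refine (integral_congr_ae (Filter.Eventually.of_forall h2)).trans ?_
  rw [integral_const, Complex.real_smul, mul_comm]

/-- The constant by which the average of `M ↦ qM - qMq` multiplies traceless operators. -/
noncomputable def fubiniStudyConstant (vol : Measure (ProjGrassmannian k H)) : ℝ :=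
  vol.real Set.univ * (k * (Module.finrank ℂ H - k)) / ((Module.finrank ℂ H : ℝ) ^ 2 - 1)

theorem integral_mul_sub_mul_mul (h : IsFubiniStudyVolume vol) (hn : 2 ≤ Module.finrank ℂ H)
    {M : H →L[ℂ] H} (hM : opTrace M = 0) :
    ∫ q : ProjGrassmannian k H, (q.1 * M - q.1 * M * q.1) ∂vol
      = (fubiniStudyConstant vol : ℂ) • M := by
  obtain ⟨a, b, hab⟩ := exists_averageCompression_eq h hn
  -- At `M = 1` the compression `qMq` is `q` itself.
  have hQ : ∫ q : ProjGrassmannian k H, q.1 ∂vol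
      = (a + b * Module.finrank ℂ H) • (1 : H →L[ℂ] H) := by
    have h1 := hab 1
    rw [averageCompression_apply h, opTrace_one] at h1
    rw [add_smul, ← h1]
    refine integral_congr_ae (Filter.Eventually.of_forall fun q => ?_)
    dsimp only
    rw [mul_one, q.2.1.isIdempotentElem.eq]
  have ht := integral_opTrace h
  rw [hQ, opTrace_smul, opTrace_one] at ht
  have hs := sum_inner_averageCompression h (stdOrthonormalBasis ℂ H)
  have hs' : ∑ i, ∑ j, inner ℂ (stdOrthonormalBasis ℂ H i) (averageCompression vol
      (rankOne ℂ (stdOrthonormalBasis ℂ H i) (stdOrthonormalBasis ℂ H j))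
        (stdOrthonormalBasis ℂ H j))
      = a * (Module.finrank ℂ H : ℂ) ^ 2 + b * Module.finrank ℂ H := by
    have h1 (i j) : inner ℂ (stdOrthonormalBasis ℂ H i) (averageCompression vol
      (rankOne ℂ (stdOrthonormalBasis ℂ H i) (stdOrthonormalBasis ℂ H j))
        (stdOrthonormalBasis ℂ H j)) = a + if i = j then b else 0 := by
      rw [hab, opTrace, trace_rankOne]
      have h2 (i j) : inner ℂ (stdOrthonormalBasis ℂ H i) (stdOrthonormalBasis ℂ H j)
          = if i = j then (1 : ℂ) else 0 :=
        orthonormal_iff_ite.1 (stdOrthonormalBasis ℂ H).orthonormal i j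
      by_cases hij : i = j
      · simp [hij]
      · simp [h2, hij, Ne.symm hij]
    simp only [h1, Finset.sum_add_distrib, Finset.sum_ite_eq, Finset.mem_univ, if_true,
      Finset.sum_const, Finset.card_univ, Fintype.card_fin, nsmul_eq_mul]
    ring
  rw [hs'] at hs
  have hl : (fubiniStudyConstant vol : ℂ) = b * Module.finrank ℂ H := by
    have hn' : (2 : ℝ) ≤ Module.finrank ℂ H := by exact_mod_cast hn
    have hne : ((Module.finrank ℂ H : ℂ) ^ 2 - 1) ≠ 0 := by
      have : ((Module.finrank ℂ H : ℝ) ^ 2 - 1) ≠ 0 := by nlinarith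
      exact_mod_cast this
    rw [fubiniStudyConstant]
    push_cast
    rw [div_eq_iff hne]
    -- With `v` the total volume, `ht` says `an + bn² = kv` and `hs` says `an² + bn = k²v`;
    -- subtracting `n` times the first from the second eliminates `a`.
    linear_combination hs - (Module.finrank ℂ H : ℂ) * ht
  have hi : ∫ q : ProjGrassmannian k H, q.1 * M ∂vol = (∫ q : ProjGrassmannian k H, q.1 ∂vol) * M :=
    ((ContinuousLinearMap.mul ℂ (H →L[ℂ] H)).flip M).integral_comp_comm
      (h.integrable continuous_subtype_val)
  rw [integral_sub (h.integrable (by fun_prop)) (h.integrable (by fun_prop)), hi, hQ,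
    ← averageCompression_apply h, hab, hM, hl, smul_mul_assoc, one_mul]
  module

theorem fubiniStudyConstant_pos (h : IsFubiniStudyVolume vol) [Nonempty (ProjGrassmannian k H)]
    (hk : 0 < k) (hkn : k < Module.finrank ℂ H) : 0 < fubiniStudyConstant vol := by
  have := h.isFiniteMeasure
  have h1 : 0 < vol.real Set.univ :=
    ENNReal.toReal_pos h.univ_ne_zero (measure_ne_top _ _)
  have h2 : (1 : ℝ) ≤ k := by exact_mod_cast hk
  have h3 : (k : ℝ) < Module.finrank ℂ H := by exact_mod_cast hkn
  have h4 : 0 < (Module.finrank ℂ H : ℝ) - k := sub_pos.2 h3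
  have h5 : 0 < (Module.finrank ℂ H : ℝ) ^ 2 - 1 := by nlinarith
  rw [fubiniStudyConstant]
  positivity

theorem nonempty_projGrassmannian (hkn : k ≤ Module.finrank ℂ H) :
    Nonempty (ProjGrassmannian k H) := by
  have hv : LinearIndependent ℂ fun i : Fin k => stdOrthonormalBasis ℂ H (Fin.castLE hkn i) :=
    (stdOrthonormalBasis ℂ H).orthonormal.linearIndependent.comp _ (Fin.castLE_injective hkn)
  let K := Submodule.span ℂ (Set.range fun i : Fin k => stdOrthonormalBasis ℂ H (Fin.castLE hkn i))
  refine ⟨⟨K.starProjection, isStarProjection_starProjection, ?_⟩⟩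
  rw [Submodule.range_starProjection, finrank_span_eq_card hv, Fintype.card_fin]

end Compression

/-! ### The three properties of the section -/

section Idempotent

variable {H : Type*} [NormedAddCommGroup H] [InnerProductSpace ℂ H] [CompleteSpace H] {k : ℕ}

theorem idemSection_self (q : ProjGrassmannian k H) :
    idemSection q q = ContinuousLinearMap.id ℂ (cotangentFiber q) := by
  ext1 A
  refine Subtype.ext ?_
  change q.1 * A.1 - q.1 * A.1 * q.1 = A.1
  rw [A.2.1, A.2.2, sub_zero]

/-- Both sides equal `Tr(A*B)`: the correction terms vanish by cyclicity of the trace, from `Bp = 0`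
on the left and `qA* = 0` on the right. -/
theorem opTrace_star_idemSection_mul (q p : ProjGrassmannian k H) (A : cotangentFiber q)
    (B : cotangentFiber p) :
    opTrace (star (idemSection q p A).1 * B.1) = opTrace (star A.1 * (idemSection p q B).1) := by
  have hp := p.2.1.isSelfAdjoint.star_eq
  have hq := q.2.1.isSelfAdjoint.star_eq
  have hA1 : star A.1 * q.1 = star A.1 := by simpa [hq] using congrArg star A.2.1
  have hA2 : q.1 * star A.1 = 0 := by simpa [hq] using congrArg star A.2.2
  have h1 : opTrace (p.1 * star A.1 * (p.1 * B.1)) = 0 := by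
    rw [B.2.1, mul_assoc, opTrace_mul_comm, mul_assoc, B.2.2, mul_zero]
    exact map_zero _
  have h2 : opTrace (star A.1 * B.1 * q.1) = 0 := by
    rw [opTrace_mul_comm, ← mul_assoc, hA2, zero_mul]
    exact map_zero _
  change opTrace (star (p.1 * A.1 - p.1 * A.1 * p.1) * B.1)
    = opTrace (star A.1 * (q.1 * B.1 - q.1 * B.1 * q.1))
  have h3 : star (p.1 * A.1 - p.1 * A.1 * p.1) * B.1
      = star A.1 * (p.1 * B.1) - p.1 * star A.1 * (p.1 * B.1) := by
    rw [star_sub, star_mul, star_mul, star_mul, hp]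
    noncomm_ring
  have h4 : star A.1 * (q.1 * B.1 - q.1 * B.1 * q.1)
      = star A.1 * q.1 * B.1 - star A.1 * q.1 * B.1 * q.1 := by noncomm_ring
  rw [h3, h4, opTrace_sub, opTrace_sub, h1, hA1, h2, B.2.1]

/-- The projection `M ↦ pM - pMp` onto the cotangent fibre. -/
def toCotangentFiber (p : ProjGrassmannian k H) : (H →L[ℂ] H) →L[ℂ] cotangentFiber p where
  toFun M := ⟨p.1 * M - p.1 * M * p.1, section_mem_cotangentFiber p M⟩
  map_add' A B := Subtype.ext (by simp only [Submodule.coe_add]; noncomm_ring)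
  map_smul' c A := Subtype.ext (by
    simp only [Submodule.coe_smul, mul_smul_comm, smul_mul_assoc, smul_sub, RingHom.id_apply])
  cont := by
    refine Continuous.subtype_mk ?_ _
    fun_prop

/-- The intermediate fibre varies with `q'`, but the composite factors through the fixed space of
all operators, where the dependence on `q'` is polynomial. -/
theorem continuous_idemSection_comp (q p : ProjGrassmannian k H) :
    Continuous fun q' => (idemSection q' p).comp (idemSection q q') := by
  have h (q' : ProjGrassmannian k H) : (idemSection q' p).comp (idemSection q q')
      = (toCotangentFiber p).comp ((ContinuousLinearMap.mul ℂ (H →L[ℂ] H) q'.1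
        - ContinuousLinearMap.mulLeftRight ℂ (H →L[ℂ] H) q'.1 q'.1).comp
          (cotangentFiber q).subtypeL) := rfl
  simp only [h]
  fun_prop

theorem opTrace_cotangentFiber (q : ProjGrassmannian k H) (A : cotangentFiber q) :
    opTrace A.1 = 0 := by
  rw [← A.2.1, opTrace_mul_comm, A.2.2]
  exact map_zero _

variable [FiniteDimensional ℂ H]

/-- In the extreme cases `q` is `0` or `1`, and `qA = A`, `Aq = 0` force `A = 0`. -/
theorem subsingleton_cotangentFiber (h : ¬(0 < k ∧ k < Module.finrank ℂ H))
    (q : ProjGrassmannian k H) : Subsingleton (cotangentFiber q) := by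
  have ht : opTrace q.1 = k := (finrank_range_eq_iff q.2.1.isIdempotentElem k).1 q.2.2
  have hle : k ≤ Module.finrank ℂ H := q.2.2 ▸ Submodule.finrank_le _
  refine subsingleton_of_forall_eq 0 fun A => Subtype.ext ?_
  change A.1 = 0
  rcases Nat.eq_zero_or_pos k with hk | hk
  · have hq : q.1 = 0 := by
      refine eq_zero_of_opTrace_star_mul_self ?_
      rw [q.2.1.isSelfAdjoint.star_eq, q.2.1.isIdempotentElem.eq, ht, hk]
      simp
    rw [← A.2.1, hq, zero_mul]
  · have hkn : k = Module.finrank ℂ H := by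
      by_contra hne
      exact h ⟨hk, lt_of_le_of_ne hle hne⟩
    have hq : q.1 = 1 := q.2.1.eq_of_mul_eq_of_opTrace_eq (IsStarProjection.one _) (one_mul _)
      (by rw [ht, opTrace_one, hkn])
    rw [← mul_one A.1, ← hq, A.2.2]

/-- The projection onto the fibre at `p` is linear and comes out of the integral; what remains is
the averaged operator on the traceless `A`, a multiplication by `l`. -/
theorem idemSection_eq_integral {vol : Measure (ProjGrassmannian k H)}
    (h : IsFubiniStudyVolume vol) (hn : 2 ≤ Module.finrank ℂ H) {l : ℝ≥0}
    (hl : (l : ℝ) = fubiniStudyConstant vol) (hl0 : 0 < l) (q p : ProjGrassmannian k H) :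
    idemSection q p = ∫ q', (idemSection q' p).comp (idemSection q q') ∂(l⁻¹ • vol) := by
  have hi : Integrable (fun q' => (idemSection q' p).comp (idemSection q q')) vol :=
    h.integrable (continuous_idemSection_comp q p)
  ext1 A
  rw [integral_smul_nnreal_measure, smul_apply,
    ContinuousLinearMap.integral_apply hi]
  have h1 : ∫ q', ((idemSection q' p).comp (idemSection q q')) A ∂vol
      = toCotangentFiber p (∫ q' : ProjGrassmannian k H,
          (q'.1 * A.1 - q'.1 * A.1 * q'.1) ∂vol) :=
    (toCotangentFiber p).integral_comp_comm (h.integrable (by fun_prop))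
  rw [h1, integral_mul_sub_mul_mul h hn (opTrace_cotangentFiber q A), ← hl, map_smul]
  have h2 : ((l : ℝ) : ℂ) • toCotangentFiber p A.1 = l • toCotangentFiber p A.1 := rfl
  rw [h2, smul_smul, inv_mul_cancel₀ hl0.ne', one_smul]
  rfl

end Idempotent

theorem mainTheorem6 {H : Type*} [NormedAddCommGroup H] [InnerProductSpace ℂ H] [CompleteSpace H]
    [FiniteDimensional ℂ H] (k : ℕ) :
    -- identity on the diagonal
    (∀ q : ProjGrassmannian k H, idemSection q q = ContinuousLinearMap.id ℂ (cotangentFiber q)) ∧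
    -- Hermitian
    (∀ (q p : ProjGrassmannian k H) (A : cotangentFiber q) (B : cotangentFiber p),
      opTrace (star (idemSection q p A).1 * B.1) = opTrace (star A.1 * (idemSection p q B).1)) ∧
    -- idempotent for the Fubini-Study volume, normalized by the constant `l⁻¹`
    ∃ vol : Measure (ProjGrassmannian k H),
      IsFubiniStudyVolume vol ∧
      (∀ vol' : Measure (ProjGrassmannian k H), IsFubiniStudyVolume vol' → vol' = vol) ∧
      ∃ l : ℝ≥0, 0 < l ∧
        (∀ q p : ProjGrassmannian k H,
          Integrable (fun q' => (idemSection q' p).comp (idemSection q q')) (l⁻¹ • vol) ∧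
          idemSection q p = ∫ q', (idemSection q' p).comp (idemSection q q') ∂(l⁻¹ • vol)) ∧
        (0 < k → k < Module.finrank ℂ H → ∀ M : H →L[ℂ] H, opTrace M = 0 →
          Integrable (fun q : ProjGrassmannian k H => q.1 * M - q.1 * M * q.1) vol ∧
          ∫ q : ProjGrassmannian k H, (q.1 * M - q.1 * M * q.1) ∂vol = (l : ℂ) • M) := by
  refine ⟨idemSection_self, opTrace_star_idemSection_mul, ?_⟩
  obtain ⟨vol, hvol, hfin⟩ := exists_isFubiniStudyVolume k H
  refine ⟨vol, hvol, fun vol' h' => h'.unique hvol, ?_⟩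
  by_cases hk : 0 < k ∧ k < Module.finrank ℂ H
  · have := nonempty_projGrassmannian (k := k) hk.2.le
    have hpos := fubiniStudyConstant_pos hvol hk.1 hk.2
    have hn : 2 ≤ Module.finrank ℂ H := by omega
    refine ⟨⟨fubiniStudyConstant vol, hpos.le⟩, hpos, fun q p => ⟨?_, ?_⟩, fun _ _ M hM => ⟨?_, ?_⟩⟩
    · exact (hvol.integrable (continuous_idemSection_comp q p)).smul_measure_nnreal
    · exact idemSection_eq_integral hvol hn rfl hpos q p
    · exact hvol.integrable (by fun_prop)
    · exact integral_mul_sub_mul_mul hvol hn hM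
  -- If `k = 0` or `k ≥ n`, every fibre is zero or the Grassmannian is empty, so any positive
  -- constant works.
  · refine ⟨1, one_pos, fun q p => ?_, fun h1 h2 => absurd ⟨h1, h2⟩ hk⟩
    have := subsingleton_cotangentFiber hk p
    refine ⟨?_, Subsingleton.elim _ _⟩
    exact (hvol.integrable (continuous_idemSection_comp q p)).smul_measure_nnreal
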